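/- Let $K$ be an algebraically closed field and let $n,d$ be integers with $2\le d<n$, $\gcd(n,d)=1$ and $d\neq 0$ in $K$ (i.e. $\operatorname{char} K$ does not divide $d$). Let $f(x)\in K[x]$ be a monic polynomial of degree $n$ without repeated roots, with roots $w_1,\dots,w_n\in K$, and let $\mathcal C$ be the smooth projective model of the smooth affine plane curve $C: y^d=f(x)$. Then $\mathcal C$ has exactly one point $\infty$ at infinity, and its other points are in bijection with the points $(a,c)\in K^2$, $c^d=f(a)$, of $C$; identify them. Embed $\mathcal C(K)$ in the Jacobian $J(\mathcal C)(K)=\operatorname{Pic}^0(\mathcal C)$ by sending $P$ to the linear equivalence class of the divisor $(P)-(\infty)$, and call the order of this class the order of $P$. Then: (i) If $P\in\mathcal C(K)$ has finite order $m>1$, then $m=d$ or $m\ge n$. (ii) There are precisely $n$ points of order $d$ on $\mathcal C$, namely the points $(w_j,0)$, $j=1,\dots,n$. (iii) A point $P=(a,c)$ of $C$ has order $n$ if and only if there exists $v(x)\in K[x]$ such that $$\deg v\le \frac{n-1}{d},\qquad f(x)=(x-a)^n+v(x)^d .$$ (iv) The curve $\mathcal C$ has a point of order $n$ if and only if there exist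 $a\in K$ and $v(x)\in K[x]$ such that $$\deg v\le \frac{n-1}{d},\qquad f(x)=(x-a)^n+v(x)^d .$$ -/

import Mathlib

open Polynomial

noncomputable section

/-! ### The complete nonsingular curve of a function field, its divisors and its Jacobian -/

/-- A closed point of the complete nonsingular curve over `K` with function field `F`
(the abstract nonsingular curve of `F / K`): a discrete valuation ring of `F` which
contains the constants `K` and has `F` as its field of fractions. -/
@[ext]
structure CurvePoint (K F : Type*) [Field K] [Field F] [Algebra K F] where
  /-- the local ring of the curve at the point -/
  localRing : ValuationSubring F
  algebraMap_mem : ∀ c : K, algebraMap K F c ∈ localRing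
  isDVR : IsDiscreteValuationRing localRing

namespace CurvePoint

variable {K F : Type*} [Field K] [Field F] [Algebra K F]

/-- The normalized multiplicative valuation of `F` at the point `P`. -/
def valuation (P : CurvePoint K F) : Valuation F (WithZero (Multiplicative ℤ)) :=
  haveI := P.isDVR
  (IsDiscreteValuationRing.maximalIdeal P.localRing).valuation F

/-- The order of vanishing at `P` of a rational function `h ≠ 0` (negative at poles). -/
def ord (P : CurvePoint K F) (h : F) : ℤ := -WithZero.log (P.valuation h)

/-- The rational function `h` is regular at `P` and takes the value `0` there,
i.e. `h` lies in the maximal ideal of the local ring at `P`. -/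
def Vanishes (P : CurvePoint K F) (h : F) : Prop := h ∈ P.localRing.nonunits

/-- The rational function `h` has a pole at `P`. -/
def IsPole (P : CurvePoint K F) (h : F) : Prop := h ∉ P.localRing

theorem ord_one (P : CurvePoint K F) : P.ord 1 = 0 := by simp [ord]

theorem ord_mul (P : CurvePoint K F) {g h : F} (hg : g ≠ 0) (hh : h ≠ 0) :
    P.ord (g * h) = P.ord g + P.ord h := by
  have h1 : P.valuation g ≠ 0 := (Valuation.ne_zero_iff _).2 hg
  have h2 : P.valuation h ≠ 0 := (Valuation.ne_zero_iff _).2 hh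
  simp only [ord, map_mul, WithZero.log_mul h1 h2]
  ring

theorem ord_inv (P : CurvePoint K F) (h : F) : P.ord h⁻¹ = -P.ord h := by
  simp only [ord, map_inv₀, WithZero.log_inv]

end CurvePoint

variable (K F : Type*) [Field K] [Field F] [Algebra K F]

/-- Divisors on the curve: finite formal integral combinations of points. -/
abbrev CurveDivisor := CurvePoint K F →₀ ℤ

/-- The degree of a divisor, for `K` algebraically closed (all points have degree one). -/
def CurveDivisor.degree : CurveDivisor K F →+ ℤ :=
  Finsupp.liftAddHom fun _ => AddMonoidHom.id ℤ

/-- The group of principal divisors `div h = ∑ ord_P(h) (P)`, for `h ≠ 0` in `F`. -/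
def CurveDivisor.principal : AddSubgroup (CurveDivisor K F) where
  carrier := {D | ∃ h : F, h ≠ 0 ∧ ∀ P : CurvePoint K F, D P = P.ord h}
  zero_mem' := ⟨1, one_ne_zero, fun P => by simp [P.ord_one]⟩
  add_mem' := by
    rintro D E ⟨g, hg, hD⟩ ⟨h, hh, hE⟩
    exact ⟨g * h, mul_ne_zero hg hh, fun P => by
      rw [Finsupp.add_apply, hD, hE, P.ord_mul hg hh]⟩
  neg_mem' := by
    rintro D ⟨h, hh, hD⟩
    exact ⟨h⁻¹, inv_ne_zero hh, fun P => by rw [Finsupp.neg_apply, hD, P.ord_inv]⟩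

/-- The group of `K`-points of the Jacobian of the curve (`K` algebraically closed):
divisors of degree zero modulo linear equivalence. -/
abbrev CurveJacobian :=
  (CurveDivisor.degree K F).ker ⧸
    (CurveDivisor.principal K F).addSubgroupOf (CurveDivisor.degree K F).ker

variable {K F}

/-- The map from the curve to its Jacobian with base point `O`:
it sends `P` to the linear equivalence class of `(P) - (O)`. -/
def CurvePoint.alb (O P : CurvePoint K F) : CurveJacobian K F :=
  QuotientAddGroup.mk ⟨Finsupp.single P 1 - Finsupp.single O 1, by
    rw [AddMonoidHom.mem_ker, map_sub]
    simp [CurveDivisor.degree]⟩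

/-! ### The curves `y ^ d = f x` -/

/-- The data of a curve `y ^ d = f(x)` over `K`, where `f` is monic of degree `n` without
multiple factors, `2 ≤ d < n`, `d` is prime to `n`, and the characteristic of `K` does not
divide `d`. -/
structure SuperellipticCurve (K : Type*) [Field K] (n d : ℕ) where
  f : K[X]
  monic : f.Monic
  natDegree_eq : f.natDegree = n
  squarefree : Squarefree f
  two_le : 2 ≤ d
  lt : d < n
  coprime : n.Coprime d
  natCast_ne_zero : (d : K) ≠ 0

namespace SuperellipticCurve

variable {K : Type*} [Field K] {n d : ℕ} (C : SuperellipticCurve K n d)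

/-- The polynomial `Y ^ d - f(X)`, as a polynomial in `Y` over `K[X]`. -/
def equation : K[X][X] := X ^ d - Polynomial.C C.f

theorem irreducible_equation : Irreducible C.equation := by
  have hd : 0 < d := lt_of_lt_of_le two_pos C.two_le
  have hn : 0 < n := hd.trans C.lt
  have hunit : ¬ IsUnit C.f := fun h => by
    have := natDegree_eq_zero_of_isUnit h
    rw [C.natDegree_eq] at this
    exact hn.ne' this
  obtain ⟨p, hp, hpf⟩ := WfDvdMonoid.exists_irreducible_factor hunit C.monic.ne_zero
  have hdeg : C.equation.natDegree = d := natDegree_X_pow_sub_C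
  have hmon : C.equation.Monic := monic_X_pow_sub_C _ hd.ne'
  have hprime : (Ideal.span {p}).IsPrime :=
    (Ideal.span_singleton_prime hp.ne_zero).2 hp.prime
  refine irreducible_of_eisenstein_criterion hprime ?_ ?_ ?_ ?_ hmon.isPrimitive
  · rw [hmon.leadingCoeff]
    exact fun h => hprime.ne_top ((Ideal.eq_top_iff_one _).2 h)
  · intro k hk
    rw [degree_eq_natDegree hmon.ne_zero, hdeg] at hk
    have hk' : k < d := by exact_mod_cast hk
    rw [Ideal.mem_span_singleton, equation, coeff_sub, coeff_X_pow, if_neg hk'.ne, coeff_C]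
    split_ifs
    · simpa using hpf
    · simp
  · rw [degree_eq_natDegree hmon.ne_zero, hdeg]
    exact_mod_cast hd
  · rw [Ideal.span_singleton_pow, Ideal.mem_span_singleton, equation, coeff_sub, coeff_X_pow,
      if_neg hd.ne, coeff_C_zero, zero_sub, dvd_neg, sq]
    exact fun h => hp.not_isUnit (C.squarefree p h)

/-- The coordinate ring `K[x, y] / (y ^ d - f(x))` of the affine curve. -/
abbrev CoordinateRing := AdjoinRoot C.equation

instance : IsDomain C.CoordinateRing :=
  AdjoinRoot.isDomain_of_prime C.irreducible_equation.prime

/-- The function field of the curve. -/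
abbrev FunctionField := FractionRing C.CoordinateRing

/-- The coordinate function `x`. -/
def x : C.FunctionField :=
  algebraMap C.CoordinateRing C.FunctionField (AdjoinRoot.of C.equation X)

/-- The coordinate function `y`. -/
def y : C.FunctionField :=
  algebraMap C.CoordinateRing C.FunctionField (AdjoinRoot.root C.equation)

/-- The points of the smooth projective model of the curve `y ^ d = f(x)`. -/
abbrev Point := CurvePoint K C.FunctionField

/-- The point `P` of the smooth projective model lies over the point `(a, c)` of the affine
curve, i.e. `x` and `y` are regular at `P`, with `x(P) = a` and `y(P) = c`. -/
def LiesOver (P : C.Point) (a c : K) : Prop :=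
  P.Vanishes (C.x - algebraMap K C.FunctionField a) ∧
    P.Vanishes (C.y - algebraMap K C.FunctionField c)

/-- The point `P` of the smooth projective model lies over infinity: `x` or `y` has a pole. -/
def LiesOverInfinity (P : C.Point) : Prop := P.IsPole C.x ∨ P.IsPole C.y

end SuperellipticCurve

end

/-! Write a function as a polynomial `g` in `y` over `K[x]` with degree less than `d` in `y`. At the
point `O` at infinity `x` has a pole of order `d` and `y` one of order `n`. As `n` and `d` are
coprime, the terms of `g` have distinct pole orders `d * k + n * i`, so the pole order of `g` is
their maximum (`valuation_fn`). A function without finite poles lies in the coordinate ring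
(`exists_algebraMap_eq`). Hence `m` kills `P` exactly when some such `g` has pole order `m` and all
its finite zeros at `P` (`nsmul_alb_eq_zero_iff_exists_fn`).

If `0 < m < n`, then `g = p(x)` and `m = d * deg p ≥ d`. The zeros of `p(x)` are stable under
multiplying `y` by `d`-th roots of unity, so `P` has ordinate zero. Conversely `x - w_j` has divisor
`d (P) - d (O)` at `P = (w_j, 0)`. If `m = n`, then `g` is a constant times `y - v(x)`. Each root
`b` of `f - v ^ d` gives a zero `(b, v(b))` of `g`, so `a` is the only root and `f - v ^ d = (x - a)
^ n`. Conversely this identity makes `y - v` divide `(x - a) ^ n`, with a cofactor not vanishing at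
`P`.

Points are valuation rings, so they must first be matched with points of the affine curve and
infinity. For each centre, one element `t` is found such that every function has the same value, as
a power of `t`, in all valuation rings with that centre. This gives both discreteness and
uniqueness; existence comes from extending local rings to valuation rings. -/

noncomputable section

/-! ### Valuation rings with a common uniform parameter -/

section UniformParameter

variable {F : Type*} [Field F]

/-- A valuation subring is a discrete valuation ring as soon as all values are powers of
the value of one element. -/
theorem ValuationSubring.isDiscreteValuationRing_of_zpow (R : ValuationSubring F) {t : F}
    (ht0 : t ≠ 0) (ht : R.valuation t < 1)
    (h : ∀ x : F, x ≠ 0 → ∃ k : ℤ, R.valuation x = R.valuation t ^ k) :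
    IsDiscreteValuationRing R := by
  have htR : t ∈ R := (R.valuation_le_one_iff t).1 ht.le
  have hv0 : 0 < R.valuation t := zero_lt_iff.2 ((Valuation.ne_zero_iff _).2 ht0)
  have key : ∀ x : R, x ≠ 0 → ∃ k : ℕ, R.valuation (x : F) = R.valuation t ^ k := by
    intro x hx
    obtain ⟨k, hk⟩ := h x (by simpa using hx)
    have h1 : R.valuation (x : F) ≤ 1 := R.valuation_le_one x
    rw [hk, zpow_le_one_iff_right_of_lt_one₀ hv0 ht] at h1
    lift k to ℕ using h1
    exact ⟨k, by simpa using hk⟩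
  apply IsDiscreteValuationRing.ofHasUnitMulPowIrreducibleFactorization
  refine ⟨⟨t, htR⟩, ⟨?_, ?_⟩, ?_⟩
  · rw [R.valuation_eq_one_iff]
    exact ht.ne
  · intro a b hab
    have ha : a ≠ 0 := by
      rintro rfl; rw [zero_mul] at hab; exact ht0 (congrArg Subtype.val hab)
    have hb : b ≠ 0 := by
      rintro rfl; rw [mul_zero] at hab; exact ht0 (congrArg Subtype.val hab)
    obtain ⟨k, hk⟩ := key a ha
    obtain ⟨l, hl⟩ := key b hb
    have hab' : t = (a : F) * b := congrArg Subtype.val hab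
    have h1 : R.valuation t ^ 1 = R.valuation t ^ (k + l) := by
      rw [pow_one, pow_add, ← hk, ← hl, ← map_mul, ← hab']
    have h2 : 1 = k + l := by
      exact pow_right_injective₀ hv0 ht.ne h1
    rw [R.valuation_eq_one_iff, R.valuation_eq_one_iff, hk, hl]
    rcases Nat.eq_zero_or_pos k with rfl | hk0
    · left; simp
    · right
      rw [show l = 0 by omega, pow_zero]
  · intro x hx
    obtain ⟨k, hk⟩ := key x hx
    refine ⟨k, ?_⟩
    have : R.valuation (x : F) = R.valuation (t ^ k) := by rw [hk, map_pow]
    obtain ⟨u, hu⟩ := (R.valuation_eq_iff _ _).1 this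
    exact ⟨u, Subtype.ext (by rw [← hu]; simp [mul_comm])⟩

/-- A family of valuation subrings has a uniform parameter `t` if `t` is in the maximal ideal of
each of them, and the value of each element is the same power of the value of `t` for all of
them. -/
def IsUniformParameter (S : Set (ValuationSubring F)) (t : F) : Prop :=
  t ≠ 0 ∧ (∀ R ∈ S, R.valuation t < 1) ∧
    ∀ x : F, x ≠ 0 → ∃ k : ℤ, ∀ R ∈ S, R.valuation x = R.valuation t ^ k

/-- Membership of `x` depends only on the sign of the exponent `k`, which is common to all rings in
`S`. -/
theorem IsUniformParameter.eq {S : Set (ValuationSubring F)} {t : F} (h : IsUniformParameter S t)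
    {R R' : ValuationSubring F} (hR : R ∈ S) (hR' : R' ∈ S) : R = R' := by
  obtain ⟨ht0, ht, hk⟩ := h
  ext x
  rcases eq_or_ne x 0 with rfl | hx
  · simp [zero_mem]
  obtain ⟨k, hk⟩ := hk x hx
  rw [← R.valuation_le_one_iff, ← R'.valuation_le_one_iff, hk R hR, hk R' hR',
    zpow_le_one_iff_right_of_lt_one₀ (zero_lt_iff.2 ((Valuation.ne_zero_iff _).2 ht0)) (ht R hR),
    zpow_le_one_iff_right_of_lt_one₀ (zero_lt_iff.2 ((Valuation.ne_zero_iff _).2 ht0)) (ht R' hR')]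

theorem IsUniformParameter.isDiscreteValuationRing {S : Set (ValuationSubring F)} {t : F}
    (h : IsUniformParameter S t) {R : ValuationSubring F} (hR : R ∈ S) :
    IsDiscreteValuationRing R :=
  R.isDiscreteValuationRing_of_zpow h.1 (h.2.1 R hR) fun x hx =>
    let ⟨k, hk⟩ := h.2.2 x hx
    ⟨k, hk R hR⟩

end UniformParameter

/-! ### Orders of functions at points, and torsion in the Jacobian -/

namespace CurvePoint

variable {K F : Type*} [Field K] [Field F] [Algebra K F] (P : CurvePoint K F)

theorem valuation_le_one_iff (h : F) : P.valuation h ≤ 1 ↔ h ∈ P.localRing := by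
  have := P.isDVR
  constructor
  · intro H
    obtain ⟨a, rfl⟩ := IsDiscreteValuationRing.exists_lift_of_le_one H
    exact a.2
  · intro H
    exact (IsDiscreteValuationRing.maximalIdeal P.localRing).valuation_le_one (K := F) ⟨h, H⟩

theorem ord_nonneg_iff {h : F} (hh : h ≠ 0) : 0 ≤ P.ord h ↔ h ∈ P.localRing := by
  have h1 : P.valuation h ≠ 0 := (Valuation.ne_zero_iff _).2 hh
  rw [← valuation_le_one_iff, ord, neg_nonneg, WithZero.log_le_iff_le_exp h1, WithZero.exp_zero]

theorem vanishes_iff {h : F} (hh : h ≠ 0) : P.Vanishes h ↔ 0 < P.ord h := by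
  rw [Vanishes, ValuationSubring.mem_nonunits_iff_or, or_iff_right hh,
    ← P.ord_nonneg_iff (inv_ne_zero hh), ord_inv]
  omega

theorem ord_pow {h : F} (hh : h ≠ 0) (k : ℕ) : P.ord (h ^ k) = k * P.ord h := by
  induction k with
  | zero => simp [ord_one]
  | succ k ih => rw [pow_succ, P.ord_mul (pow_ne_zero _ hh) hh, ih]; push_cast; ring

theorem ord_zpow {h : F} (hh : h ≠ 0) (k : ℤ) : P.ord (h ^ k) = k * P.ord h := by
  obtain ⟨k, rfl | rfl⟩ := k.eq_nat_or_neg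
  · simpa using P.ord_pow hh k
  · rw [zpow_neg, ord_inv, zpow_natCast, P.ord_pow hh]; ring

theorem exists_ord_eq_one : ∃ h : F, h ≠ 0 ∧ P.ord h = 1 := by
  have := P.isDVR
  obtain ⟨π, hπ⟩ :=
    (IsDiscreteValuationRing.maximalIdeal P.localRing).valuation_exists_uniformizer F
  refine ⟨π, ?_, ?_⟩
  · rintro rfl; rw [map_zero] at hπ; exact WithZero.exp_ne_zero hπ.symm
  · rw [ord, valuation, hπ, WithZero.log_exp, neg_neg]

theorem ord_eq_zero_iff {h : F} (hh : h ≠ 0) :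
    P.ord h = 0 ↔ P.localRing.valuation h = 1 := by
  have h1 := P.ord_nonneg_iff hh
  have h2 := P.vanishes_iff hh
  rw [Vanishes, ValuationSubring.mem_nonunits_iff] at h2
  rw [← ValuationSubring.valuation_le_one_iff] at h1
  constructor
  · intro h0
    exact le_antisymm (h1.1 h0.ge) (not_lt.1 fun h3 => by have := h2.1 h3; omega)
  · intro h0
    have := h1.2 h0.le
    have : ¬ 0 < P.ord h := fun h3 => (h2.2 h3).ne h0
    omega

theorem ord_eq_mul_of_valuation_eq {t h : F} (ht : t ≠ 0) (hh : h ≠ 0) {k : ℤ}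
    (hk : P.localRing.valuation h = P.localRing.valuation t ^ k) : P.ord h = k * P.ord t := by
  have hv : P.localRing.valuation t ≠ 0 := (Valuation.ne_zero_iff _).2 ht
  have h1 : P.ord (h * t ^ (-k)) = 0 := by
    rw [P.ord_eq_zero_iff (mul_ne_zero hh (zpow_ne_zero _ ht)), map_mul, hk, map_zpow₀, zpow_neg,
      mul_inv_cancel₀ (zpow_ne_zero _ hv)]
  rw [P.ord_mul hh (zpow_ne_zero _ ht), P.ord_zpow ht] at h1
  linarith

/-- A function of order one has the value of some `t ^ k`, so the positive integer `P.ord t` divides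
one. -/
theorem ord_eq_one_of_isUniformParameter {S : Set (ValuationSubring F)} {t : F}
    (h : IsUniformParameter S t) (hP : P.localRing ∈ S) : P.ord t = 1 := by
  obtain ⟨ht0, ht, hk⟩ := h
  obtain ⟨π, hπ, hπ1⟩ := P.exists_ord_eq_one
  obtain ⟨k, hk⟩ := hk π hπ
  have h1 := P.ord_eq_mul_of_valuation_eq ht0 hπ (hk _ hP)
  have h2 : 0 < P.ord t := (P.vanishes_iff ht0).1 (ht _ hP)
  rw [hπ1] at h1
  exact Int.eq_one_of_dvd_one h2.le ⟨k, by rw [h1, mul_comm]⟩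

theorem ord_eq_of_isUniformParameter {S : Set (ValuationSubring F)} {t x : F}
    (h : IsUniformParameter S t) (hP : P.localRing ∈ S) (hx : x ≠ 0) {k : ℤ}
    (hk : P.localRing.valuation x = P.localRing.valuation t ^ k) : P.ord x = k := by
  rw [P.ord_eq_mul_of_valuation_eq h.1 hx hk, P.ord_eq_one_of_isUniformParameter h hP, mul_one]

theorem existsUnique_of_isUniformParameter {S : Set (ValuationSubring F)} {t : F}
    (h : IsUniformParameter S t) (hS : S.Nonempty)
    (hK : ∀ R ∈ S, ∀ c : K, algebraMap K F c ∈ R) :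
    ∃! P : CurvePoint K F, P.localRing ∈ S := by
  obtain ⟨R, hR⟩ := hS
  exact ⟨⟨R, hK R hR, h.isDiscreteValuationRing hR⟩, hR, fun Q hQ =>
    CurvePoint.ext (h.eq hQ hR)⟩

variable {P}

theorem Vanishes.mem {h : F} (hh : P.Vanishes h) : h ∈ P.localRing :=
  P.localRing.nonunits_le hh

/-- The image of `P` in the Jacobian is killed by `m` iff `m` times the divisor `(P) - (O)` is the divisor of a function. -/
theorem nsmul_alb_eq_zero_iff (O P : CurvePoint K F) (m : ℕ) :
    m • O.alb P = 0 ↔ ∃ h : F, h ≠ 0 ∧ ∀ Q : CurvePoint K F,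
      (m • (Finsupp.single P 1 - Finsupp.single O 1) : CurveDivisor K F) Q = Q.ord h := by
  rw [alb, ← QuotientAddGroup.mk_nsmul, QuotientAddGroup.eq_zero_iff, AddSubgroup.mem_addSubgroupOf]
  rfl

theorem alb_self (O : CurvePoint K F) : O.alb O = 0 := by
  rw [← one_nsmul (O.alb O), nsmul_alb_eq_zero_iff]
  exact ⟨1, one_ne_zero, fun Q => by simp [ord_one]⟩

theorem addOrderOf_alb_self (O : CurvePoint K F) : addOrderOf (O.alb O) = 1 := by
  rw [alb_self, addOrderOf_zero]

end CurvePoint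

/-! ### Functions as polynomials in `y` over `K[x]` -/

namespace SuperellipticCurve

variable {K : Type*} [Field K] {n d : ℕ} (C : SuperellipticCurve K n d)

theorem pos (C : SuperellipticCurve K n d) : 0 < d := two_pos.trans_le C.two_le

theorem monic_equation : C.equation.Monic := monic_X_pow_sub_C _ C.pos.ne'

theorem natDegree_equation : C.equation.natDegree = d := natDegree_X_pow_sub_C

/-- The rational function on the curve defined by a polynomial in `y` over `K[x]`. -/
def fn : K[X][X] →+* C.FunctionField :=
  (algebraMap C.CoordinateRing C.FunctionField).comp (AdjoinRoot.mk C.equation)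

theorem fn_X : C.fn X = C.y := by simp [fn, y]

theorem fn_C (p : K[X]) : C.fn (Polynomial.C p) = aeval C.x p := by
  have : (C.fn.comp Polynomial.C) = (aeval C.x : K[X] →ₐ[K] C.FunctionField).toRingHom := by
    refine Polynomial.ringHom_ext (fun a => ?_) ?_
    · simp only [RingHom.comp_apply, AlgHom.toRingHom_eq_coe, RingHom.coe_coe, aeval_C, fn,
        AdjoinRoot.mk_C]
      rw [IsScalarTower.algebraMap_apply K C.CoordinateRing C.FunctionField,
        IsScalarTower.algebraMap_apply K K[X] C.CoordinateRing]
      rfl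
    · simp [fn, x]
  exact RingHom.congr_fun this p

theorem fn_C_C (a : K) : C.fn (Polynomial.C (Polynomial.C a)) = algebraMap K C.FunctionField a := by
  rw [fn_C, aeval_C]

theorem fn_C_X : C.fn (Polynomial.C X) = C.x := by rw [fn_C, aeval_X]

theorem fn_eq_sum (g : K[X][X]) :
    C.fn g = ∑ i ∈ g.support, aeval C.x (g.coeff i) * C.y ^ i := by
  conv_lhs => rw [g.as_sum_support_C_mul_X_pow]
  simp [fn_C, fn_X]

/-- A nonzero multiple of the monic `C.equation` has degree at least `d` in `y`. -/
theorem fn_injOn {g : K[X][X]} (hg : g.degree < d) (h : C.fn g = 0) : g = 0 := by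
  have h1 : AdjoinRoot.mk C.equation g = 0 :=
    IsFractionRing.injective C.CoordinateRing C.FunctionField (by rw [map_zero]; exact h)
  rw [AdjoinRoot.mk_eq_zero] at h1
  refine eq_zero_of_dvd_of_degree_lt h1 ?_
  rwa [degree_eq_natDegree C.monic_equation.ne_zero, natDegree_equation]

theorem exists_reduced (a : C.CoordinateRing) :
    ∃ g : K[X][X], g.degree < d ∧ algebraMap C.CoordinateRing C.FunctionField a = C.fn g := by
  obtain ⟨g, rfl⟩ := AdjoinRoot.mk_surjective a
  refine ⟨g %ₘ C.equation, ?_, ?_⟩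
  · have := degree_modByMonic_lt g C.monic_equation
    rwa [degree_eq_natDegree C.monic_equation.ne_zero, natDegree_equation] at this
  · rw [fn, RingHom.comp_apply]
    congr 1
    rw [AdjoinRoot.mk_eq_mk, modByMonic_eq_sub_mul_div _ C.equation, sub_sub_cancel]
    exact dvd_mul_right _ _

theorem y_pow : C.y ^ d = aeval C.x C.f := by
  rw [← fn_X, ← fn_C, ← sub_eq_zero, ← map_pow, ← map_sub]
  change algebraMap _ _ (AdjoinRoot.mk C.equation C.equation) = 0
  rw [AdjoinRoot.mk_self, map_zero]

theorem transcendental_x : Transcendental K C.x := by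
  rw [transcendental_iff]
  intro p hp
  rw [← fn_C] at hp
  have := C.fn_injOn (lt_of_le_of_lt degree_C_le (by exact_mod_cast C.pos)) hp
  simpa using this

theorem y_ne_zero : C.y ≠ 0 := by
  intro h
  rw [← fn_X] at h
  refine X_ne_zero (C.fn_injOn ?_ h)
  rw [degree_X]
  exact_mod_cast C.two_le

theorem aeval_x_ne_zero {p : K[X]} (hp : p ≠ 0) : aeval C.x p ≠ 0 := fun h =>
  hp ((transcendental_iff.1 C.transcendental_x) p h)

theorem x_ne_zero : C.x ≠ 0 := by
  simpa using C.aeval_x_ne_zero (X_ne_zero (R := K))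

theorem x_sub_ne_zero (a : K) : C.x - algebraMap K C.FunctionField a ≠ 0 := by
  simpa using C.aeval_x_ne_zero (X_sub_C_ne_zero a)

/-! ### The point at infinity -/

/-- The pole order at infinity of a polynomial in `y` of degree less than `d` over `K[x]`. -/
def poleOrder (_C : SuperellipticCurve K n d) (g : K[X][X]) : ℕ :=
  g.support.sup fun i => d * (g.coeff i).natDegree + n * i

/-- The valuation subrings of the function field which contain the constants, but not `x`. -/
def ringsAtInfinity : Set (ValuationSubring C.FunctionField) :=
  {R | (∀ c : K, algebraMap K C.FunctionField c ∈ R) ∧ C.x ∉ R}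

/-- A uniformizer at infinity. -/
def uniformizerAtInfinity : C.FunctionField :=
  (C.x ^ Nat.gcdB n d * C.y ^ Nat.gcdA n d)⁻¹

theorem uniformizerAtInfinity_ne_zero : C.uniformizerAtInfinity ≠ 0 :=
  inv_ne_zero (mul_ne_zero (zpow_ne_zero _ C.x_ne_zero) (zpow_ne_zero _ C.y_ne_zero))

variable {C} in
theorem isTrivialOn_of_forall_mem {R : ValuationSubring C.FunctionField}
    (hR : ∀ c : K, algebraMap K C.FunctionField c ∈ R) : R.valuation.IsTrivialOn K where
  eq_one c hc := by
    apply le_antisymm ((R.valuation_le_one_iff _).2 (hR c))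
    have h1 := (R.valuation_le_one_iff _).2 (hR c⁻¹)
    have h2 : R.valuation (algebraMap K C.FunctionField c) ≠ 0 :=
      (Valuation.ne_zero_iff _).2 ((_root_.map_ne_zero _).2 hc)
    rwa [map_inv₀, map_inv₀, inv_le_one₀ (zero_lt_iff.2 h2)] at h1

section
variable {C} {R : ValuationSubring C.FunctionField}

theorem one_lt_valuation_x (hR : R ∈ C.ringsAtInfinity) : 1 < R.valuation C.x :=
  not_le.1 fun h => hR.2 ((R.valuation_le_one_iff _).1 h)

theorem valuation_aeval_x (hR : R ∈ C.ringsAtInfinity) {p : K[X]} (hp : p ≠ 0) :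
    R.valuation (aeval C.x p) = R.valuation C.x ^ p.natDegree :=
  have := isTrivialOn_of_forall_mem hR.1
  valuation_aeval_eq_valuation_X_pow_natDegree_of_one_lt_valuation_X _ (one_lt_valuation_x hR) hp

/-- Since `y ^ d = f(x)` has the value of `x ^ n`, the Bézout relation `1 = n A + d B` shows that
`(x ^ B * y ^ A) ^ d` has the value of `x`. -/
theorem valuation_x (hR : R ∈ C.ringsAtInfinity) :
    R.valuation C.x = (R.valuation C.uniformizerAtInfinity)⁻¹ ^ d := by
  have hx : R.valuation C.x ≠ 0 := (Valuation.ne_zero_iff _).2 C.x_ne_zero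
  have hy : R.valuation C.y ^ d = R.valuation C.x ^ n := by
    rw [← map_pow, C.y_pow, valuation_aeval_x hR C.monic.ne_zero, C.natDegree_eq]
  have hgcd : (1 : ℤ) = n * Nat.gcdA n d + d * Nat.gcdB n d := by
    rw [← Nat.gcd_eq_gcd_ab, C.coprime.gcd_eq_one, Nat.cast_one]
  rw [uniformizerAtInfinity, map_inv₀, inv_inv, map_mul, map_zpow₀, map_zpow₀, mul_pow,
    ← zpow_natCast, ← zpow_natCast, zpow_comm (R.valuation C.y), zpow_natCast (R.valuation C.y), hy,
    ← zpow_natCast, ← zpow_mul, ← zpow_mul, ← zpow_add₀ hx]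
  conv_lhs => rw [← zpow_one (R.valuation C.x), hgcd]
  congr 1
  ring

theorem valuation_y (hR : R ∈ C.ringsAtInfinity) :
    R.valuation C.y = (R.valuation C.uniformizerAtInfinity)⁻¹ ^ n := by
  have hy : R.valuation C.y ^ d = R.valuation C.x ^ n := by
    rw [← map_pow, C.y_pow, valuation_aeval_x hR C.monic.ne_zero, C.natDegree_eq]
  rw [valuation_x hR, ← pow_mul, mul_comm, pow_mul] at hy
  exact (pow_left_inj₀ zero_le zero_le C.pos.ne').1 hy

theorem valuation_uniformizerAtInfinity_lt_one (hR : R ∈ C.ringsAtInfinity) :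
    R.valuation C.uniformizerAtInfinity < 1 := by
  by_contra! h
  have h1 := one_lt_valuation_x hR
  rw [valuation_x hR] at h1
  exact h1.not_ge (pow_le_one₀ zero_le (inv_le_one_of_one_le₀ h))

/-- Modulo `d` the pole order of the `i`-th term is `n * i`. These residues differ for distinct `i <
d`, so one term strictly dominates and no cancellation occurs. -/
theorem valuation_fn (hR : R ∈ C.ringsAtInfinity) {g : K[X][X]} (hg : g.degree < d) (hg0 : g ≠ 0) :
    R.valuation (C.fn g) = (R.valuation C.uniformizerAtInfinity)⁻¹ ^ C.poleOrder g := by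
  set γ := (R.valuation C.uniformizerAtInfinity)⁻¹ with hγ
  have hγ1 : 1 < γ :=
    (one_lt_inv₀ (zero_lt_iff.2 ((Valuation.ne_zero_iff _).2 C.uniformizerAtInfinity_ne_zero))).2
      (valuation_uniformizerAtInfinity_lt_one hR)
  have hterm : ∀ i ∈ g.support, R.valuation (aeval C.x (g.coeff i) * C.y ^ i) =
      γ ^ (d * (g.coeff i).natDegree + n * i) := by
    intro i hi
    rw [map_mul, map_pow, valuation_aeval_x hR (mem_support_iff.1 hi), valuation_x hR,
      valuation_y hR, ← pow_mul, ← pow_mul, ← pow_add]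
  obtain ⟨j, hj, hj'⟩ := Finset.exists_mem_eq_sup g.support (support_nonempty.2 hg0)
    fun i => d * (g.coeff i).natDegree + n * i
  rw [poleOrder, hj', ← hterm j hj, fn_eq_sum]
  refine Valuation.map_sum_eq_of_lt _ hj fun i hi => ?_
  rw [Finset.mem_sdiff, Finset.mem_singleton] at hi
  rw [hterm i hi.1, hterm j hj]
  refine pow_lt_pow_right₀ hγ1 (lt_of_le_of_ne ?_ ?_)
  · rw [← hj']
    exact Finset.le_sup (f := fun i => d * (g.coeff i).natDegree + n * i) hi.1
  · intro heq
    have hlt : ∀ k ∈ g.support, k < d := fun k hk => by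
      exact_mod_cast (le_degree_of_mem_supp k hk).trans_lt hg
    have h1 : n * i ≡ n * j [MOD d] := by
      have : d * (g.coeff i).natDegree + n * i ≡ d * (g.coeff j).natDegree + n * j [MOD d] := by
        rw [heq]
      simpa [Nat.ModEq, Nat.mul_add_mod] using this
    have h2 : i ≡ j [MOD d] := Nat.ModEq.cancel_left_of_coprime C.coprime.symm h1
    exact hi.2 (h2.eq_of_lt_of_lt (hlt i hi.1) (hlt j hj))

end

theorem isUniformParameter_uniformizerAtInfinity :
    IsUniformParameter C.ringsAtInfinity C.uniformizerAtInfinity := by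
  refine ⟨C.uniformizerAtInfinity_ne_zero, fun R hR => valuation_uniformizerAtInfinity_lt_one hR,
    fun h hh => ?_⟩
  obtain ⟨a, b, hb, rfl⟩ := IsFractionRing.div_surjective C.CoordinateRing h
  obtain ⟨ha', hb'⟩ := div_ne_zero_iff.1 hh
  obtain ⟨p, hp, hpa⟩ := C.exists_reduced a
  obtain ⟨q, hq, hqb⟩ := C.exists_reduced b
  rw [hpa] at ha'
  rw [hqb] at hb'
  refine ⟨(C.poleOrder q : ℤ) - C.poleOrder p, fun R hR => ?_⟩
  rw [hpa, hqb, map_div₀, valuation_fn hR hp (by rintro rfl; simp at ha'),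
    valuation_fn hR hq (by rintro rfl; simp at hb'), inv_pow, inv_pow, div_eq_mul_inv, inv_inv,
    zpow_sub₀ ((Valuation.ne_zero_iff _).2 C.uniformizerAtInfinity_ne_zero), zpow_natCast,
    zpow_natCast, div_eq_mul_inv, mul_comm]

/-- Being transcendental, `x` is outside the integral closure of `K`, so some valuation ring
containing that closure omits `x`. -/
theorem ringsAtInfinity_nonempty : C.ringsAtInfinity.Nonempty := by
  let S : Subring C.FunctionField := (integralClosure K C.FunctionField).toSubring
  have : IsIntegrallyClosedIn S C.FunctionField :=
    inferInstanceAs (IsIntegrallyClosedIn (integralClosure K C.FunctionField) C.FunctionField)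
  have hx : C.x ∉ S := fun h =>
    C.transcendental_x ((mem_integralClosure_iff K C.FunctionField).1 h).isAlgebraic
  obtain ⟨V, hV, hxV⟩ := Subring.exists_le_valuationSubring_of_isIntegrallyClosedIn hx
  exact ⟨V, fun c => hV ((integralClosure K C.FunctionField).algebraMap_mem c), hxV⟩

theorem aeval_mem {R : ValuationSubring C.FunctionField}
    (hK : ∀ c : K, algebraMap K C.FunctionField c ∈ R) {h : C.FunctionField} (hh : h ∈ R)
    (p : K[X]) : aeval h p ∈ R := by
  rw [aeval_eq_sum_range]
  refine R.toSubring.sum_mem fun i _ => ?_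
  rw [Algebra.smul_def]
  exact R.mul_mem _ _ (hK _) (R.toSubring.pow_mem hh i)

theorem _root_.ValuationSubring.mem_of_pow_mem {F : Type*} [Field F] (R : ValuationSubring F)
    {h : F} {k : ℕ} (hk : k ≠ 0)
    (hh : h ^ k ∈ R) : h ∈ R := by
  rw [← R.valuation_le_one_iff] at hh ⊢
  rwa [map_pow, pow_le_one_iff_of_nonneg zero_le hk] at hh

theorem liesOverInfinity_iff (P : C.Point) :
    C.LiesOverInfinity P ↔ P.localRing ∈ C.ringsAtInfinity := by
  constructor
  · intro h
    refine ⟨P.algebraMap_mem, fun hx => h.elim (fun h' => h' hx) fun h' => h' ?_⟩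
    -- If `x` is regular, so is `y ^ d = f(x)`, hence `y`.
    refine P.localRing.mem_of_pow_mem C.pos.ne' ?_
    rw [C.y_pow]
    exact C.aeval_mem P.algebraMap_mem hx _
  · exact fun h => Or.inl h.2

theorem existsUnique_liesOverInfinity : ∃! O : C.Point, C.LiesOverInfinity O := by
  simp_rw [liesOverInfinity_iff]
  exact CurvePoint.existsUnique_of_isUniformParameter C.isUniformParameter_uniformizerAtInfinity
    C.ringsAtInfinity_nonempty fun R hR => hR.1

variable {C} in
theorem ord_fn_of_liesOverInfinity {O : C.Point} (hO : C.LiesOverInfinity O) {g : K[X][X]}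
    (hg : g.degree < d) (hg0 : g ≠ 0) : O.ord (C.fn g) = -C.poleOrder g := by
  rw [liesOverInfinity_iff] at hO
  refine O.ord_eq_of_isUniformParameter C.isUniformParameter_uniformizerAtInfinity hO
    (fun h => hg0 (C.fn_injOn hg h)) ?_
  rw [valuation_fn hO hg hg0, inv_pow, zpow_neg, zpow_natCast]

end SuperellipticCurve

/-! ### The points of the affine curve -/

namespace SuperellipticCurve

variable {K : Type*} [Field K] {n d : ℕ} (C : SuperellipticCurve K n d)

section Affine

variable {a c : K} (hac : c ^ d = C.f.eval a)

/-- Evaluation of regular functions at the point `(a, c)` of the affine curve. -/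
def evalAt : C.CoordinateRing →+* K :=
  AdjoinRoot.lift (evalRingHom a) c (by simp [equation, hac])

theorem evalAt_mk (g : K[X][X]) :
    C.evalAt hac (AdjoinRoot.mk C.equation g) = (g.eval (Polynomial.C c)).eval a := by
  rw [evalAt, AdjoinRoot.lift_mk, ← coe_evalRingHom a, eval, hom_eval₂]
  simp

@[simp]
theorem evalAt_of (p : K[X]) : C.evalAt hac (AdjoinRoot.of C.equation p) = p.eval a := by
  simp [evalAt]

@[simp]
theorem evalAt_root : C.evalAt hac (AdjoinRoot.root C.equation) = c := by
  simp [evalAt]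

/-- Divide by `y - c`, then divide the remainder, a polynomial in `x`, by `x - a`. -/
theorem mem_ker_evalAt_iff (h : C.CoordinateRing) :
    h ∈ RingHom.ker (C.evalAt hac) ↔
      h ∈ Ideal.span {AdjoinRoot.mk C.equation (Polynomial.C (X - Polynomial.C a)),
        AdjoinRoot.mk C.equation (X - Polynomial.C (Polynomial.C c))} := by
  constructor
  · intro hh
    obtain ⟨g, rfl⟩ := AdjoinRoot.mk_surjective h
    rw [RingHom.mem_ker, evalAt_mk] at hh
    obtain ⟨q, hq⟩ := X_sub_C_dvd_sub_C_eval (a := Polynomial.C c) (p := g)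
    obtain ⟨r, hr⟩ := X_sub_C_dvd_sub_C_eval (a := a) (p := g.eval (Polynomial.C c))
    rw [hh, map_zero, sub_zero] at hr
    rw [hr, sub_eq_iff_eq_add] at hq
    rw [hq, map_add, map_mul, map_mul, map_mul]
    exact Ideal.add_mem _
      (Ideal.mul_mem_right _ _ (Ideal.subset_span (Set.mem_insert_of_mem _ rfl)))
      (Ideal.mul_mem_right _ _ (Ideal.subset_span (Set.mem_insert _ _)))
  · intro hh
    refine Ideal.span_le.2 ?_ hh
    rintro _ (rfl | rfl) <;> simp [RingHom.mem_ker]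

instance ker_evalAt_isPrime : (RingHom.ker (C.evalAt hac)).IsPrime := RingHom.ker_isPrime _

theorem x_eq : C.x - algebraMap K C.FunctionField a = algebraMap C.CoordinateRing C.FunctionField
    (AdjoinRoot.mk C.equation (Polynomial.C (X - Polynomial.C a))) := by
  rw [← fn_C_X, ← fn_C_C, ← map_sub, ← map_sub]; rfl

theorem y_eq : C.y - algebraMap K C.FunctionField c = algebraMap C.CoordinateRing C.FunctionField
    (AdjoinRoot.mk C.equation (X - Polynomial.C (Polynomial.C c))) := by
  rw [← fn_X, ← fn_C_C, ← map_sub]; rfl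

/-- The valuation subrings of the function field centered at the point `(a, c)`. -/
def ringsAt (a c : K) : Set (ValuationSubring C.FunctionField) :=
  {R | (∀ r : K, algebraMap K C.FunctionField r ∈ R) ∧
    C.x - algebraMap K C.FunctionField a ∈ R.nonunits ∧
    C.y - algebraMap K C.FunctionField c ∈ R.nonunits}

theorem algebraMap_mem_of_mem {R : ValuationSubring C.FunctionField}
    (hK : ∀ r : K, algebraMap K C.FunctionField r ∈ R) (hx : C.x ∈ R) (hy : C.y ∈ R)
    (h : C.CoordinateRing) : algebraMap C.CoordinateRing C.FunctionField h ∈ R := by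
  obtain ⟨g, -, hg⟩ := C.exists_reduced h
  rw [hg, fn_eq_sum]
  exact R.toSubring.sum_mem fun i _ =>
    R.mul_mem _ _ (C.aeval_mem hK hx _) (R.toSubring.pow_mem hy i)

variable {C} in
theorem algebraMap_mem_of_mem_ringsAt {R : ValuationSubring C.FunctionField}
    (hR : R ∈ C.ringsAt a c) (h : C.CoordinateRing) :
    algebraMap C.CoordinateRing C.FunctionField h ∈ R := by
  refine C.algebraMap_mem_of_mem hR.1 ?_ ?_ h
  · simpa using R.add_mem _ _ (R.nonunits_le hR.2.1) (hR.1 a)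
  · simpa using R.add_mem _ _ (R.nonunits_le hR.2.2) (hR.1 c)

variable {C} in
theorem valuation_algebraMap_lt_one {R : ValuationSubring C.FunctionField}
    (hR : R ∈ C.ringsAt a c) {h : C.CoordinateRing} (hh : C.evalAt hac h = 0) :
    R.valuation (algebraMap C.CoordinateRing C.FunctionField h) < 1 := by
  rw [← RingHom.mem_ker, mem_ker_evalAt_iff, Ideal.mem_span_pair] at hh
  obtain ⟨p, q, rfl⟩ := hh
  have h1 := (R.valuation_le_one_iff _).2 (algebraMap_mem_of_mem_ringsAt hR p)
  have h2 := (R.valuation_le_one_iff _).2 (algebraMap_mem_of_mem_ringsAt hR q)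
  have h3 := hR.2.1
  have h4 := hR.2.2
  rw [x_eq, ValuationSubring.mem_nonunits_iff] at h3
  rw [y_eq, ValuationSubring.mem_nonunits_iff] at h4
  rw [map_add, map_mul, map_mul]
  refine Valuation.map_add_lt _ ?_ ?_ <;> rw [map_mul]
  · exact mul_lt_one_of_nonneg_of_lt_one_right h1 zero_le h3
  · exact mul_lt_one_of_nonneg_of_lt_one_right h2 zero_le h4

variable {C} in
-- The function differs from its nonzero constant value at `(a, c)` by an element of value less than
-- one.
theorem valuation_algebraMap_eq_one {R : ValuationSubring C.FunctionField}
    (hR : R ∈ C.ringsAt a c) {h : C.CoordinateRing} (hh : C.evalAt hac h ≠ 0) :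
    R.valuation (algebraMap C.CoordinateRing C.FunctionField h) = 1 := by
  set r := C.evalAt hac h with hr
  have h1 : C.evalAt hac (h - AdjoinRoot.mk _ (Polynomial.C (Polynomial.C r))) = 0 := by
    rw [map_sub, evalAt_mk, ← hr]; simp
  have h2 := valuation_algebraMap_lt_one hac hR h1
  have h3 : algebraMap C.CoordinateRing C.FunctionField
      (AdjoinRoot.mk _ (Polynomial.C (Polynomial.C r))) = algebraMap K C.FunctionField r :=
    C.fn_C_C r
  have h4 : R.valuation (algebraMap K C.FunctionField r) = 1 :=
    (isTrivialOn_of_forall_mem hR.1).eq_one r hh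
  rw [map_sub, h3] at h2
  have := Valuation.map_add_eq_of_lt_left R.valuation (h2.trans_eq h4.symm)
  rw [add_sub_cancel] at this
  exact this.trans h4

open Classical in
/-- A local parameter at the point `(a, c)` of the curve. -/
def localParameter (a c : K) : C.CoordinateRing :=
  if c = 0 then AdjoinRoot.root C.equation
  else AdjoinRoot.mk C.equation (Polynomial.C (X - Polynomial.C a))

theorem localParameter_ne_zero (a c : K) : C.localParameter a c ≠ 0 := by
  rw [localParameter]
  split_ifs
  · intro h
    apply C.y_ne_zero
    rw [y, h, map_zero]
  · intro h
    apply C.x_sub_ne_zero a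
    rw [x_eq, h, map_zero]

theorem evalAt_localParameter : C.evalAt hac (C.localParameter a c) = 0 := by
  rw [localParameter]
  split_ifs with h
  · rw [← AdjoinRoot.mk_X, evalAt_mk]; simp [h]
  · rw [evalAt_mk]; simp

theorem mk_X_pow :
    AdjoinRoot.mk C.equation X ^ d = AdjoinRoot.mk C.equation (Polynomial.C C.f) := by
  rw [← sub_eq_zero, ← map_pow, ← map_sub]
  exact AdjoinRoot.mk_self

theorem exists_eq_X_sub_C_mul {w : K} (hw : C.f.IsRoot w) :
    ∃ g : K[X], C.f = (X - Polynomial.C w) * g ∧ g.eval w ≠ 0 := by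
  obtain ⟨g, hg⟩ := dvd_iff_isRoot.2 hw
  refine ⟨g, hg, fun h => ?_⟩
  obtain ⟨q, rfl⟩ := dvd_iff_isRoot.2 h
  exact not_isUnit_X_sub_C w (C.squarefree _ ⟨q, by rw [hg, mul_assoc]⟩)

/-- Smoothness at `(a, c)`: the maximal ideal becomes principal once functions `s` not vanishing
there are inverted. It suffices to treat the generators `x - a` and `y - c` with one common `s`. -/
theorem exists_mul_eq_localParameter_mul {h : C.CoordinateRing} (hh : C.evalAt hac h = 0) :
    ∃ s u, C.evalAt hac s ≠ 0 ∧ s * h = C.localParameter a c * u := by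
  suffices H : ∃ s u u', C.evalAt hac s ≠ 0 ∧
      s * AdjoinRoot.mk C.equation (Polynomial.C (X - Polynomial.C a)) =
        C.localParameter a c * u ∧
      s * AdjoinRoot.mk C.equation (X - Polynomial.C (Polynomial.C c)) =
        C.localParameter a c * u' by
    obtain ⟨s, u, u', hs, hu, hu'⟩ := H
    rw [← RingHom.mem_ker, mem_ker_evalAt_iff, Ideal.mem_span_pair] at hh
    obtain ⟨p, q, rfl⟩ := hh
    exact ⟨s, p * u + q * u', hs, by linear_combination p * hu + q * hu'⟩
  by_cases hc : c = 0
  · subst hc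
    rw [zero_pow C.pos.ne'] at hac
    obtain ⟨g, hg, hga⟩ := C.exists_eq_X_sub_C_mul hac.symm
    -- Here `f = (x - a) g` with `g(a) ≠ 0` because `f` is squarefree, so `g * (x - a) = y ^ d`.
    refine ⟨AdjoinRoot.mk C.equation (Polynomial.C g), AdjoinRoot.mk C.equation X ^ (d - 1),
      AdjoinRoot.mk C.equation (Polynomial.C g), ?_, ?_, ?_⟩
    · simpa using hga
    · rw [localParameter, if_pos rfl, ← AdjoinRoot.mk_X, ← pow_succ', Nat.sub_add_cancel C.pos,
        mk_X_pow, ← map_mul, ← map_mul, hg, mul_comm]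
    · rw [localParameter, if_pos rfl, ← AdjoinRoot.mk_X]
      simp [mul_comm]
  · obtain ⟨r, hr⟩ := X_sub_C_dvd_sub_C_eval (a := a) (p := C.f)
    have hgeom := (Commute.all (X : K[X][X]) (Polynomial.C (Polynomial.C c))).geom_sum₂_mul d
    -- `G * (y - c) = y ^ d - c ^ d = f(x) - f(a)` is a multiple of `x - a`, and `G` takes the value
    -- `d * c ^ (d - 1) ≠ 0` at `(a, c)`.
    set G := ∑ i ∈ Finset.range d, (X : K[X][X]) ^ i * Polynomial.C (Polynomial.C c) ^ (d - 1 - i)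
      with hG
    refine ⟨AdjoinRoot.mk C.equation G, AdjoinRoot.mk C.equation G,
      AdjoinRoot.mk C.equation (Polynomial.C r), ?_, ?_, ?_⟩
    · rw [evalAt_mk, hG]
      have : ∀ i ∈ Finset.range d, c ^ i * c ^ (d - 1 - i) = c ^ (d - 1) := fun i hi => by
        rw [← pow_add]; congr 1; have := Finset.mem_range.1 hi; omega
      simp only [eval_finsetSum, eval_mul, eval_pow, eval_X, eval_C]
      rw [Finset.sum_congr rfl this]
      simpa using ⟨C.natCast_ne_zero, fun h => absurd h hc⟩
    · rw [localParameter, if_neg hc, mul_comm]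
    · rw [localParameter, if_neg hc, ← map_mul, hgeom, ← map_mul, ← map_mul, ← hr, map_sub,
        map_sub, map_sub, map_pow, mk_X_pow, ← hac]
      simp

/-- The local ring at `(a, c)` is a Noetherian domain with nonzero principal maximal ideal, hence a
discrete valuation ring; clear denominators in `h = unit * t ^ k`. The exponent `k` does not refer
to any valuation ring of the function field, which makes the parameter uniform. -/
theorem exists_pow_mul_eq {h : C.CoordinateRing} (hh : h ≠ 0) :
    ∃ (k : ℕ) (s u : C.CoordinateRing), C.evalAt hac s ≠ 0 ∧ C.evalAt hac u ≠ 0 ∧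
      s * h = C.localParameter a c ^ k * u := by
  set p := RingHom.ker (C.evalAt hac) with hp
  set t := C.localParameter a c with ht
  let A := Localization.AtPrime p
  have hinj : Function.Injective (algebraMap C.CoordinateRing A) :=
    IsLocalization.injective A p.primeCompl_le_nonZeroDivisors
  have : IsDomain A := IsLocalization.isDomain_localization p.primeCompl_le_nonZeroDivisors
  have : IsNoetherianRing A := IsLocalization.isNoetherianRing p.primeCompl A inferInstance
  have hunit : ∀ s : C.CoordinateRing, C.evalAt hac s ≠ 0 → IsUnit (algebraMap _ A s) :=
    fun s hs => IsLocalization.map_units A (⟨s, hs⟩ : p.primeCompl)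
  have hmax : IsLocalRing.maximalIdeal A = Ideal.span {algebraMap _ A t} := by
    rw [← Localization.AtPrime.map_eq_maximalIdeal]
    apply le_antisymm
    · rw [Ideal.map_le_iff_le_comap]
      intro b hb
      obtain ⟨s, u, hs, hu⟩ := C.exists_mul_eq_localParameter_mul hac hb
      rw [Ideal.mem_comap, ← Ideal.unit_mul_mem_iff_mem _ (hunit s hs), ← map_mul, hu, map_mul]
      exact Ideal.mul_mem_right _ _ (Ideal.mem_span_singleton_self _)
    · rw [Ideal.span_singleton_le_iff_mem]
      exact Ideal.mem_map_of_mem _ (C.evalAt_localParameter hac)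
  have ht0 : algebraMap _ A t ≠ 0 := fun h0 =>
    C.localParameter_ne_zero a c (hinj (h0.trans (map_zero _).symm))
  have hfield : ¬ IsField A := by
    rw [IsLocalRing.isField_iff_maximalIdeal_eq, hmax, Ideal.span_singleton_eq_bot]
    exact ht0
  have hprin : (IsLocalRing.maximalIdeal A).IsPrincipal := ⟨⟨_, hmax⟩⟩
  have : IsDiscreteValuationRing A :=
    ((IsDiscreteValuationRing.TFAE A hfield).out 4 0).1 hprin
  have hirr : Irreducible (algebraMap _ A t) :=
    (IsDiscreteValuationRing.irreducible_iff_uniformizer _).2 hmax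
  obtain ⟨k, v, hv⟩ := IsDiscreteValuationRing.eq_unit_mul_pow_irreducible
    (fun h0 => hh (hinj (h0.trans (map_zero _).symm)) : algebraMap _ A h ≠ 0) hirr
  obtain ⟨u, ⟨s, hs⟩, hus⟩ := IsLocalization.exists_mk'_eq p.primeCompl (v : A)
  have hsv : algebraMap _ A s * v = algebraMap _ A u := by
    rw [← hus, mul_comm]; exact IsLocalization.mk'_spec A u ⟨s, hs⟩
  refine ⟨k, s, u, hs, ?_, hinj ?_⟩
  · intro hu
    have h1 : IsUnit (algebraMap _ A u) := by
      rw [← hsv]; exact (hunit s hs).mul v.isUnit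
    exact (IsLocalization.AtPrime.isUnit_to_map_iff A p u).1 h1 hu
  · rw [map_mul, hv, map_mul, map_pow, ← hsv]; ring

theorem isUniformParameter_localParameter (hac : c ^ d = C.f.eval a) :
    IsUniformParameter (C.ringsAt a c)
    (algebraMap C.CoordinateRing C.FunctionField (C.localParameter a c)) := by
  have hinj := IsFractionRing.injective C.CoordinateRing C.FunctionField
  have h0 : algebraMap C.CoordinateRing C.FunctionField (C.localParameter a c) ≠ 0 := fun h =>
    C.localParameter_ne_zero a c (hinj (h.trans (map_zero _).symm))
  refine ⟨h0, fun R hR => valuation_algebraMap_lt_one hac hR (C.evalAt_localParameter hac),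
    fun h hh => ?_⟩
  have key : ∀ b : C.CoordinateRing, b ≠ 0 → ∃ k : ℕ, ∀ R ∈ C.ringsAt a c,
      R.valuation (algebraMap C.CoordinateRing C.FunctionField b) =
        R.valuation (algebraMap C.CoordinateRing C.FunctionField (C.localParameter a c)) ^ k := by
    intro b hb
    obtain ⟨k, s, u, hs, hu, hsu⟩ := C.exists_pow_mul_eq hac hb
    refine ⟨k, fun R hR => ?_⟩
    have := congrArg (fun z => R.valuation (algebraMap C.CoordinateRing C.FunctionField z)) hsu
    simpa [valuation_algebraMap_eq_one hac hR hs, valuation_algebraMap_eq_one hac hR hu] using this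
  obtain ⟨p, q, hq, rfl⟩ := IsFractionRing.div_surjective C.CoordinateRing h
  obtain ⟨hp', hq'⟩ := div_ne_zero_iff.1 hh
  obtain ⟨k, hk⟩ := key p (by rintro rfl; simp at hp')
  obtain ⟨l, hl⟩ := key q (by rintro rfl; simp at hq')
  refine ⟨(k : ℤ) - l, fun R hR => ?_⟩
  rw [map_div₀, hk R hR, hl R hR, zpow_sub₀ ((Valuation.ne_zero_iff _).2 h0), zpow_natCast,
    zpow_natCast]

/-- A proper ideal of a subring lies in the nonunits of some valuation ring above that subring; take
the kernel of evaluation at `(a, c)`. -/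
theorem ringsAt_nonempty (hac : c ^ d = C.f.eval a) : (C.ringsAt a c).Nonempty := by
  let S : Subring C.FunctionField := (algebraMap C.CoordinateRing C.FunctionField).range
  have hinj := IsFractionRing.injective C.CoordinateRing C.FunctionField
  let e : C.CoordinateRing ≃+* S :=
    RingEquiv.ofBijective (algebraMap C.CoordinateRing C.FunctionField).rangeRestrict
      ⟨fun x y h => hinj (congrArg Subtype.val h), RingHom.rangeRestrict_surjective _⟩
  let I : Ideal S := (RingHom.ker (C.evalAt hac)).comap e.symm
  have hI : I ≠ ⊤ := Ideal.comap_ne_top _ (C.ker_evalAt_isPrime hac).ne_top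
  obtain ⟨V, hV, hIV⟩ := Ideal.image_subset_nonunits_valuationSubring I hI
  have hmem : ∀ h : C.CoordinateRing, C.evalAt hac h = 0 →
      algebraMap C.CoordinateRing C.FunctionField h ∈ V.nonunits := fun h hh =>
    hIV ⟨e h, by simpa [I, RingHom.mem_ker] using hh, rfl⟩
  refine ⟨V, fun r => ?_, ?_, ?_⟩
  · rw [← fn_C_C]
    exact hV ⟨_, rfl⟩
  · rw [x_eq]
    exact hmem _ (by simp)
  · rw [y_eq]
    exact hmem _ (by simp)

theorem liesOver_iff (P : C.Point) (a c : K) : C.LiesOver P a c ↔ P.localRing ∈ C.ringsAt a c :=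
  ⟨fun h => ⟨P.algebraMap_mem, h⟩, fun h => h.2⟩

theorem existsUnique_liesOver (hac : c ^ d = C.f.eval a) : ∃! P : C.Point, C.LiesOver P a c := by
  simp_rw [liesOver_iff]
  exact CurvePoint.existsUnique_of_isUniformParameter (C.isUniformParameter_localParameter hac)
    (C.ringsAt_nonempty hac) fun R hR => hR.1

variable {C} {P : C.Point}

theorem LiesOver.ord_eq_zero (hP : C.LiesOver P a c)
    {h : C.CoordinateRing} (hh : C.evalAt hac h ≠ 0) :
    P.ord (algebraMap C.CoordinateRing C.FunctionField h) = 0 := by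
  rw [liesOver_iff] at hP
  have h1 := valuation_algebraMap_eq_one hac hP hh
  rwa [CurvePoint.ord_eq_zero_iff]
  intro h0
  rw [h0] at h1; simp at h1

theorem LiesOver.ord_pos (hP : C.LiesOver P a c)
    {h : C.CoordinateRing} (h0 : h ≠ 0) (hh : C.evalAt hac h = 0) :
    0 < P.ord (algebraMap C.CoordinateRing C.FunctionField h) := by
  rw [liesOver_iff] at hP
  have h1 := valuation_algebraMap_lt_one hac hP hh
  rw [← CurvePoint.vanishes_iff]
  · exact h1
  · exact fun h => h0 (IsFractionRing.injective C.CoordinateRing C.FunctionField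
      (h.trans (map_zero _).symm))

theorem LiesOver.ord_localParameter (hP : C.LiesOver P a c) (hac : c ^ d = C.f.eval a) :
    P.ord (algebraMap C.CoordinateRing C.FunctionField (C.localParameter a c)) = 1 :=
  P.ord_eq_one_of_isUniformParameter (C.isUniformParameter_localParameter hac)
    ((C.liesOver_iff P a c).1 hP)

theorem LiesOver.not_liesOverInfinity (hP : C.LiesOver P a c) : ¬ C.LiesOverInfinity P := by
  intro h
  rw [liesOverInfinity_iff] at h
  have := P.localRing.add_mem _ _ hP.1.mem (P.algebraMap_mem a)
  exact h.2 (by simpa using this)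

theorem LiesOver.unique (hP : C.LiesOver P a c) {a' c' : K} (hP' : C.LiesOver P a' c') :
    a = a' ∧ c = c' := by
  have key : ∀ (h : C.FunctionField) (r r' : K), P.Vanishes (h - algebraMap K _ r) →
      P.Vanishes (h - algebraMap K _ r') → r = r' := by
    intro h r r' h1 h2
    by_contra hne
    have h3 : P.localRing.valuation (algebraMap K C.FunctionField (r' - r)) = 1 :=
      (isTrivialOn_of_forall_mem P.algebraMap_mem).eq_one _ (sub_ne_zero.2 (Ne.symm hne))
    have h4 : algebraMap K C.FunctionField (r' - r) =
        (h - algebraMap K _ r) - (h - algebraMap K _ r') := by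
      rw [map_sub]; ring
    rw [h4] at h3
    exact (Valuation.map_sub_lt _ h1 h2).ne h3
  exact ⟨key _ _ _ hP.1 hP'.1, key _ _ _ hP.2 hP'.2⟩

end Affine

/-! ### Nullstellensatz for the affine curve, and functions without finite poles -/

section AlgClosed

variable [IsAlgClosed K]

/-- By integrality over `K[x]`, `M` contains some nonzero `p(x)`, hence a linear factor `x - a`.
Then it contains `y ^ d - f(a)`, hence a factor `y - c`. -/
theorem exists_mem_of_isPrime {M : Ideal C.CoordinateRing} [hM : M.IsPrime] (hM0 : M ≠ ⊥) :
    ∃ (a c : K) (hac : c ^ d = C.f.eval a), RingHom.ker (C.evalAt hac) ≤ M := by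
  have hfin : Module.Finite K[X] C.CoordinateRing := C.monic_equation.finite_adjoinRoot
  have : Algebra.IsIntegral K[X] C.CoordinateRing := Algebra.IsIntegral.of_finite _ _
  have hroot : ∀ (φ : K[X] →+* C.CoordinateRing) (p : K[X]), p ≠ 0 → φ p ∈ M →
      (∀ r : K, r ≠ 0 → φ (Polynomial.C r) ∉ M) →
      ∃ a ∈ p.roots, φ (X - Polynomial.C a) ∈ M := by
    intro φ p hp hpM hC
    have := (IsAlgClosed.splits p).eq_prod_roots
    rw [this, map_mul] at hpM
    have := (hM.mem_or_mem hpM).resolve_left (hC _ (leadingCoeff_ne_zero.2 hp))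
    rw [map_multiset_prod, Multiset.map_map, hM.multiset_prod_mem_iff_exists_mem] at this
    obtain ⟨_, h1, h2⟩ := this
    obtain ⟨a, ha, rfl⟩ := Multiset.mem_map.1 h1
    exact ⟨a, ha, h2⟩
  have hC : ∀ r : K, r ≠ 0 → AdjoinRoot.mk C.equation (Polynomial.C (Polynomial.C r)) ∉ M := by
    intro r hr hrM
    refine hM.ne_top (Ideal.eq_top_of_isUnit_mem _ hrM ?_)
    exact (((isUnit_iff_ne_zero.2 hr).map Polynomial.C).map Polynomial.C).map _
  have hcomap : M.comap (algebraMap K[X] C.CoordinateRing) ≠ ⊥ := fun h =>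
    hM0 (Ideal.eq_bot_of_comap_eq_bot h)
  obtain ⟨p, hpM, hp⟩ := Submodule.exists_mem_ne_zero_of_ne_bot hcomap
  obtain ⟨a, -, ha⟩ := hroot ((AdjoinRoot.mk C.equation).comp Polynomial.C) p hp hpM hC
  have hq : (X ^ d - Polynomial.C (C.f.eval a) : K[X]) ≠ 0 :=
    (monic_X_pow_sub_C _ C.pos.ne').ne_zero
  obtain ⟨c, hc, hcM⟩ := hroot ((AdjoinRoot.mk C.equation).comp (mapRingHom Polynomial.C))
    (X ^ d - Polynomial.C (C.f.eval a)) hq (by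
      obtain ⟨r, hr⟩ := X_sub_C_dvd_sub_C_eval (a := a) (p := C.f)
      have h1 : ((AdjoinRoot.mk C.equation).comp (mapRingHom Polynomial.C))
          (X ^ d - Polynomial.C (C.f.eval a)) = ((AdjoinRoot.mk C.equation).comp Polynomial.C)
            (X - Polynomial.C a) * ((AdjoinRoot.mk C.equation).comp Polynomial.C) r := by
        rw [← map_mul, ← hr]
        simp only [map_sub, map_pow, RingHom.comp_apply, coe_mapRingHom, map_X, map_C, C.mk_X_pow]
      rw [h1]
      exact Ideal.mul_mem_right _ _ ha) (by simpa using hC)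
  refine ⟨a, c, ?_, ?_⟩
  · have := (mem_roots'.1 hc).2
    simpa [sub_eq_zero] using this
  · intro h hh
    rw [mem_ker_evalAt_iff] at hh
    refine Ideal.span_le.2 ?_ hh
    rintro _ (rfl | rfl)
    · exact ha
    · simpa using hcM

variable {C} in
-- The regular functions vanishing at `P` form a prime ideal `M`. Were it zero, every nonzero
-- quotient of regular functions would have order zero at `P`, yet some function has order one.
theorem exists_liesOver {P : C.Point} (hP : ¬ C.LiesOverInfinity P) :
    ∃ a c : K, c ^ d = C.f.eval a ∧ C.LiesOver P a c := by
  simp only [LiesOverInfinity, CurvePoint.IsPole, not_or, not_not] at hP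
  have hmem := C.algebraMap_mem_of_mem P.algebraMap_mem hP.1 hP.2
  let φ : C.CoordinateRing →+* P.localRing :=
    (algebraMap C.CoordinateRing C.FunctionField).codRestrict P.localRing.toSubring hmem
  let M : Ideal C.CoordinateRing := (IsLocalRing.maximalIdeal P.localRing).comap φ
  have hMmem : ∀ h ∈ M, P.Vanishes (algebraMap C.CoordinateRing C.FunctionField h) := fun h hh =>
    ValuationSubring.mem_nonunits_iff_exists_mem_maximalIdeal.2 ⟨_, hh⟩
  have hM0 : M ≠ ⊥ := by
    intro hbot
    have hunit : ∀ h : C.CoordinateRing, algebraMap C.CoordinateRing C.FunctionField h ≠ 0 →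
        P.ord (algebraMap C.CoordinateRing C.FunctionField h) = 0 := by
      intro h hh
      have h1 := (P.ord_nonneg_iff hh).2 (hmem h)
      have h2 : ¬ P.Vanishes (algebraMap C.CoordinateRing C.FunctionField h) := by
        intro hv
        obtain ⟨h3, h4⟩ := ValuationSubring.mem_nonunits_iff_exists_mem_maximalIdeal.1 hv
        have h5 : h ∈ M := h4
        rw [hbot, Ideal.mem_bot] at h5
        rw [h5, map_zero] at hh
        exact hh rfl
      rw [P.vanishes_iff hh] at h2
      omega
    obtain ⟨π, hπ, hπ1⟩ := P.exists_ord_eq_one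
    obtain ⟨p, q, hq, rfl⟩ := IsFractionRing.div_surjective C.CoordinateRing π
    obtain ⟨hp', hq'⟩ := div_ne_zero_iff.1 hπ
    rw [div_eq_mul_inv, P.ord_mul hp' (inv_ne_zero hq'), P.ord_inv, hunit _ hp', hunit _ hq'] at hπ1
    simp at hπ1
  obtain ⟨a, c, hac, hle⟩ := C.exists_mem_of_isPrime hM0
  refine ⟨a, c, hac, ?_, ?_⟩
  · rw [x_eq]
    exact hMmem _ (hle (by simp [RingHom.mem_ker]))
  · rw [y_eq]
    exact hMmem _ (hle (by simp [RingHom.mem_ker]))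

/-- A rational function without poles at the finite points is in the coordinate ring. -/
theorem exists_algebraMap_eq {h : C.FunctionField}
    (hh : ∀ P : C.Point, ¬ C.LiesOverInfinity P → 0 ≤ P.ord h) :
    ∃ r : C.CoordinateRing, algebraMap C.CoordinateRing C.FunctionField r = h := by
  rcases eq_or_ne h 0 with rfl | h0
  · exact ⟨0, map_zero _⟩
  obtain ⟨p, q, hq, rfl⟩ := IsFractionRing.div_surjective C.CoordinateRing h
  obtain ⟨hp', hq'⟩ := div_ne_zero_iff.1 h0
  have hp : p ≠ 0 := by rintro rfl; simp at hp'
  have hq0 : q ≠ 0 := by rintro rfl; simp at hq'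
  -- The ideal of denominators of `p / q`. If it were proper, all its elements would vanish at some
  -- point `(a, c)`.
  let I : Ideal C.CoordinateRing := (Ideal.span {q}).colon {p}
  have hI : I = ⊤ := by
    by_contra hI
    obtain ⟨M, hM, hIM⟩ := I.exists_le_maximal hI
    have hqM : q ∈ M := hIM (by
      rw [Submodule.mem_colon_singleton, smul_eq_mul]
      exact Ideal.mul_mem_right _ _ (Ideal.mem_span_singleton_self q))
    have hM0 : M ≠ ⊥ := fun h => hq0 (by rwa [h, Ideal.mem_bot] at hqM)
    have := hM.isPrime
    obtain ⟨a, c, hac, hle⟩ := C.exists_mem_of_isPrime hM0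
    have hM' : ∀ s ∈ M, C.evalAt hac s = 0 := by
      intro s hs
      by_contra hs0
      refine hM.ne_top (Ideal.eq_top_iff_one _ |>.2 ?_)
      have h1 : s * AdjoinRoot.mk _ (Polynomial.C (Polynomial.C (C.evalAt hac s)⁻¹)) - 1 ∈ M :=
        hle (by rw [RingHom.mem_ker, map_sub, map_mul, evalAt_mk]; simp [hs0])
      have h2 := Ideal.sub_mem _ (Ideal.mul_mem_right
        (AdjoinRoot.mk _ (Polynomial.C (Polynomial.C (C.evalAt hac s)⁻¹))) _ hs) h1
      rwa [sub_sub_cancel] at h2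
    obtain ⟨P, hP, -⟩ := C.existsUnique_liesOver hac
    obtain ⟨k, s, u, hs, hu, hk⟩ := C.exists_pow_mul_eq hac hp
    obtain ⟨l, s', u', hs', hu', hl⟩ := C.exists_pow_mul_eq hac hq0
    set t := C.localParameter a c
    have hinj := IsFractionRing.injective C.CoordinateRing C.FunctionField
    have hne : ∀ {b : C.CoordinateRing}, b ≠ 0 →
        algebraMap C.CoordinateRing C.FunctionField b ≠ 0 := fun hb h =>
      hb (hinj (h.trans (map_zero _).symm))
    have hne' : ∀ {b : C.CoordinateRing}, C.evalAt hac b ≠ 0 → b ≠ 0 := fun hb h => hb (by simp [h])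
    have hord : ∀ {b s u : C.CoordinateRing} {k : ℕ}, b ≠ 0 → C.evalAt hac s ≠ 0 →
        C.evalAt hac u ≠ 0 → s * b = t ^ k * u →
        P.ord (algebraMap C.CoordinateRing C.FunctionField b) = k := by
      intro b s u k hb hs hu h
      have h1 := congrArg (fun z => P.ord (algebraMap C.CoordinateRing C.FunctionField z)) h
      have ht := C.localParameter_ne_zero a c
      simp only [map_mul, map_pow] at h1
      rw [P.ord_mul (hne (hne' hs)) (hne hb), P.ord_mul (pow_ne_zero _ (hne ht)) (hne (hne' hu)),
        P.ord_pow (hne ht), hP.ord_eq_zero hac hs, hP.ord_eq_zero hac hu,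
        hP.ord_localParameter hac] at h1
      simpa using h1
    have hkl := hh P hP.not_liesOverInfinity
    rw [div_eq_mul_inv, P.ord_mul hp' (inv_ne_zero hq'), P.ord_inv, hord hp hs hu hk,
      hord hq0 hs' hu' hl] at hkl
    have hlk : l ≤ k := by omega
    -- Since `p / q` has order `k - l ≥ 0` at `(a, c)`, the function `s * u'` is a denominator that
    -- does not vanish there.
    have hmem : s * u' ∈ I := by
      rw [Submodule.mem_colon_singleton, smul_eq_mul, Ideal.mem_span_singleton]
      refine ⟨t ^ (k - l) * u * s', ?_⟩
      have : t ^ k = t ^ l * t ^ (k - l) := by rw [← pow_add, Nat.add_sub_cancel' hlk]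
      rw [this] at hk
      linear_combination u' * hk - t ^ (k - l) * u * hl
    have := hM' _ (hIM hmem)
    rw [map_mul] at this
    exact (mul_ne_zero hs hu') this
  have h1 : (1 : C.CoordinateRing) ∈ I := by rw [hI]; trivial
  rw [Submodule.mem_colon_singleton, one_smul, Ideal.mem_span_singleton] at h1
  obtain ⟨r, rfl⟩ := h1
  exact ⟨r, by rw [map_mul, mul_div_cancel_left₀ _ hq']⟩

end AlgClosed

end SuperellipticCurve

/-! ### Functions of pole order at most `n` -/

namespace SuperellipticCurve

variable {K : Type*} [Field K] {n d : ℕ} (C : SuperellipticCurve K n d)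

theorem poleOrder_C (p : K[X]) : C.poleOrder (Polynomial.C p) = d * p.natDegree := by
  rcases eq_or_ne p 0 with rfl | hp
  · simp [poleOrder]
  · simp [poleOrder, support_C hp]

theorem le_poleOrder {g : K[X][X]} {i : ℕ} (hi : g.coeff i ≠ 0) :
    d * (g.coeff i).natDegree + n * i ≤ C.poleOrder g :=
  Finset.le_sup (f := fun i => d * (g.coeff i).natDegree + n * i) (mem_support_iff.2 hi)

theorem mul_ne (C : SuperellipticCurve K n d) (k : ℕ) : d * k ≠ n := by
  rintro rfl
  have h1 : d ∣ Nat.gcd (d * k) d := Nat.dvd_gcd (dvd_mul_right _ _) dvd_rfl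
  rw [C.coprime.gcd_eq_one] at h1
  have := Nat.le_of_dvd one_pos h1
  have := C.two_le
  omega

variable {C} in
-- Any term involving `y` contributes at least `n`.
theorem eq_C_of_poleOrder_lt {g : K[X][X]} (h : C.poleOrder g < n) :
    ∃ p : K[X], g = Polynomial.C p ∧ C.poleOrder g = d * p.natDegree := by
  suffices H : g.natDegree = 0 by
    rw [eq_C_of_natDegree_eq_zero H] at *
    exact ⟨_, rfl, C.poleOrder_C _⟩
  by_contra hne
  have hg : g ≠ 0 := by rintro rfl; simp at hne
  have h1 := C.le_poleOrder (leadingCoeff_ne_zero.2 hg : g.coeff g.natDegree ≠ 0)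
  have := Nat.le_mul_of_pos_right n (Nat.pos_of_ne_zero hne)
  omega

variable {C} in
-- A term in `y ^ 2` or higher exceeds `n`, a nonconstant coefficient of `y` does too, and `y` must
-- occur because `d` does not divide `n`.
theorem exists_eq_of_poleOrder_eq {g : K[X][X]} (h : C.poleOrder g = n) :
    ∃ (p : K[X]) (e : K), e ≠ 0 ∧ d * p.natDegree < n ∧
      g = Polynomial.C p + Polynomial.C (Polynomial.C e) * X := by
  have hn : 0 < n := C.pos.trans C.lt
  have hg : g ≠ 0 := by
    rintro rfl
    simp [poleOrder] at h
    omega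
  have h1 := C.le_poleOrder (leadingCoeff_ne_zero.2 hg : g.coeff g.natDegree ≠ 0)
  rw [h] at h1
  have h2 : g.natDegree ≤ 1 := by
    by_contra! h2
    have := Nat.mul_le_mul_left n h2
    omega
  have h3 : g.natDegree = 1 := by
    by_contra h3
    have h4 : g.natDegree = 0 := by omega
    rw [eq_C_of_natDegree_eq_zero h4, poleOrder_C] at h
    exact C.mul_ne _ h
  have h5 : (g.coeff 1).natDegree = 0 := by
    rw [h3, mul_one] at h1
    have : d * (g.coeff 1).natDegree = 0 := by omega
    exact (mul_eq_zero.1 this).resolve_left C.pos.ne'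
  have h6 : g.coeff 1 ≠ 0 := h3 ▸ leadingCoeff_ne_zero.2 hg
  obtain ⟨e, he⟩ := natDegree_eq_zero.1 h5
  refine ⟨g.coeff 0, e, ?_, ?_, ?_⟩
  · rintro rfl
    rw [map_zero] at he
    exact h6 he.symm
  · by_cases h7 : g.coeff 0 = 0
    · rw [h7, natDegree_zero, mul_zero]; exact hn
    · have := C.le_poleOrder h7
      rw [h, mul_zero, add_zero] at this
      exact lt_of_le_of_ne this (C.mul_ne _)
  · conv_lhs => rw [eq_X_add_C_of_natDegree_le_one h2]
    rw [he, add_comm]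

theorem poleOrder_X_sub_C {v : K[X]} (hv : d * v.natDegree < n) :
    C.poleOrder (X - Polynomial.C v) = n := by
  apply le_antisymm
  · refine Finset.sup_le fun i hi => ?_
    have h1 : i ≤ 1 := (le_natDegree_of_mem_supp i hi).trans (natDegree_X_sub_C v).le
    interval_cases i
    · simpa using hv.le
    · simp
  · have := C.le_poleOrder (g := X - Polynomial.C v) (i := 1) (by simp)
    simpa [coeff_C] using this

theorem algebraMap_mk (g : K[X][X]) :
    algebraMap C.CoordinateRing C.FunctionField (AdjoinRoot.mk C.equation g) = C.fn g := rfl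

variable {C}

theorem LiesOver.ord_fn_eq_zero {P : C.Point} {a c : K} (hP : C.LiesOver P a c)
    (hac : c ^ d = C.f.eval a) {g : K[X][X]} (hg : (g.eval (Polynomial.C c)).eval a ≠ 0) :
    P.ord (C.fn g) = 0 := by
  rw [← algebraMap_mk]
  exact hP.ord_eq_zero hac (by rwa [evalAt_mk])

theorem LiesOver.ord_fn_pos {P : C.Point} {a c : K} (hP : C.LiesOver P a c)
    (hac : c ^ d = C.f.eval a) {g : K[X][X]} (hg0 : C.fn g ≠ 0)
    (hg : (g.eval (Polynomial.C c)).eval a = 0) : 0 < P.ord (C.fn g) := by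
  rw [← algebraMap_mk] at hg0 ⊢
  exact hP.ord_pos hac (by rintro h; rw [h, map_zero] at hg0; exact hg0 rfl) (by rwa [evalAt_mk])

theorem eq_of_liesOverInfinity {O O' : C.Point} (hO : C.LiesOverInfinity O)
    (hO' : C.LiesOverInfinity O') : O = O' :=
  C.existsUnique_liesOverInfinity.unique hO hO'

theorem not_liesOverInfinity_of_addOrderOf_ne_one {O P : C.Point} (hO : C.LiesOverInfinity O)
    (h : addOrderOf (O.alb P) ≠ 1) : ¬ C.LiesOverInfinity P := fun hP => by
  obtain rfl := eq_of_liesOverInfinity hP hO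
  exact h (CurvePoint.addOrderOf_alb_self _)

/-! ### Torsion points of order at most `n` -/

section AlgClosed

variable [IsAlgClosed K] {O P : C.Point}

/-- A function with divisor `m (P) - m (O)` has its poles only at infinity, so it is a polynomial in
`x` and `y`, which can be reduced to degree less than `d` in `y`. -/
theorem nsmul_alb_eq_zero_iff_exists_fn (hO : C.LiesOverInfinity O) (hP : ¬ C.LiesOverInfinity P)
    (m : ℕ) : m • O.alb P = 0 ↔ ∃ g : K[X][X], g.degree < d ∧ g ≠ 0 ∧ C.poleOrder g = m ∧
      P.ord (C.fn g) = m ∧ ∀ Q : C.Point, Q ≠ P → ¬ C.LiesOverInfinity Q → Q.ord (C.fn g) = 0 := by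
  have hPO : P ≠ O := by rintro rfl; exact hP hO
  rw [CurvePoint.nsmul_alb_eq_zero_iff]
  constructor
  · rintro ⟨h, h0, hdiv⟩
    have hOm : O.ord h = -m := by
      rw [← hdiv O]; simp [hPO]
    have hPm : P.ord h = m := by
      rw [← hdiv P]; simp [hPO.symm]
    have hQm : ∀ Q : C.Point, Q ≠ P → ¬ C.LiesOverInfinity Q → Q.ord h = 0 := by
      intro Q hQP hQ
      have hQO : Q ≠ O := by rintro rfl; exact hQ hO
      rw [← hdiv Q]; simp [hQP.symm, hQO.symm]
    obtain ⟨r, rfl⟩ := C.exists_algebraMap_eq (h := h) fun Q hQ => by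
      by_cases hQP : Q = P
      · rw [hQP, hPm]; positivity
      · exact (hQm Q hQP hQ).ge
    obtain ⟨g, hg, hrg⟩ := C.exists_reduced r
    rw [hrg] at h0 hOm hPm hQm
    have hg0 : g ≠ 0 := by rintro rfl; simp at h0
    refine ⟨g, hg, hg0, ?_, hPm, hQm⟩
    rw [ord_fn_of_liesOverInfinity hO hg hg0] at hOm
    omega
  · rintro ⟨g, hg, hg0, hgm, hPm, hQm⟩
    refine ⟨C.fn g, fun h => hg0 (C.fn_injOn hg h), fun Q => ?_⟩
    by_cases hQP : Q = P
    · subst hQP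
      rw [hPm]; simp [hPO.symm]
    by_cases hQ : C.LiesOverInfinity Q
    · obtain rfl := eq_of_liesOverInfinity hQ hO
      rw [ord_fn_of_liesOverInfinity hO hg hg0, hgm]; simp [hPO]
    · have hQO : Q ≠ O := by rintro rfl; exact hQ hO
      rw [hQm Q hQP hQ]; simp [Ne.symm hQP, hQO.symm]

theorem exists_pow_eq_and_ne (C : SuperellipticCurve K n d) {c : K} (hc : c ≠ 0) :
    ∃ c' : K, c' ^ d = c ^ d ∧ c' ≠ c := by
  classical
  have hsep : (X ^ d - Polynomial.C (c ^ d)).Separable :=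
    separable_X_pow_sub_C _ C.natCast_ne_zero (pow_ne_zero _ hc)
  have hcard : (X ^ d - Polynomial.C (c ^ d)).roots.toFinset.card = d := by
    rw [Multiset.toFinset_card_of_nodup (nodup_roots hsep),
      splits_iff_card_roots.1 (IsAlgClosed.splits _), natDegree_X_pow_sub_C]
  obtain ⟨c', hc', hne⟩ := Finset.exists_mem_ne (by rw [hcard]; exact C.two_le) c
  refine ⟨c', ?_, hne⟩
  rw [Multiset.mem_toFinset, mem_roots'] at hc'
  simpa [sub_eq_zero] using hc'.2

/-- The witness is a polynomial in `x` alone, of pole order `m = d * deg p`. If `c ≠ 0`, it would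
also vanish at a second point `(a, c')` with `c' ^ d = c ^ d`. -/
theorem le_and_liesOver_of_nsmul_alb_eq_zero (hO : C.LiesOverInfinity O)
    (hP : ¬ C.LiesOverInfinity P) {m : ℕ} (hm0 : 0 < m) (hmn : m < n) (hm : m • O.alb P = 0) :
    d ≤ m ∧ ∃ w, C.f.IsRoot w ∧ C.LiesOver P w 0 := by
  obtain ⟨g, hg, hg0, hgm, hPm, hQm⟩ := (nsmul_alb_eq_zero_iff_exists_fn hO hP m).1 hm
  obtain ⟨p, rfl, hp⟩ := eq_C_of_poleOrder_lt (hgm.trans_lt hmn)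
  rw [hgm] at hp
  have hdeg : 0 < p.natDegree := Nat.pos_of_ne_zero fun h => by
    rw [h, mul_zero] at hp; omega
  refine ⟨hp ▸ Nat.le_mul_of_pos_right d hdeg, ?_⟩
  obtain ⟨a, c, hac, hPac⟩ := exists_liesOver hP
  have hpa : p.eval a = 0 := by
    by_contra hpa
    have := hPac.ord_fn_eq_zero hac (g := Polynomial.C p) (by simpa using hpa)
    omega
  rcases eq_or_ne c 0 with rfl | hc
  · refine ⟨a, ?_, hPac⟩
    rw [zero_pow C.pos.ne'] at hac
    exact hac.symm
  · obtain ⟨c', hc', hne⟩ := C.exists_pow_eq_and_ne hc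
    have hac' := hc'.trans hac
    obtain ⟨Q, hQ, -⟩ := C.existsUnique_liesOver hac'
    have hQP : Q ≠ P := by
      rintro rfl
      exact hne (hQ.unique hPac).2
    have h1 := hQ.ord_fn_pos hac' (g := Polynomial.C p) (fun h => hg0 (C.fn_injOn hg h))
      (by simpa using hpa)
    have h2 := hQm Q hQP hQ.not_liesOverInfinity
    omega

/-- The function `x - w` has divisor `d (P) - d (O)`: near `P` it is `y ^ d` up to a unit, and `y`
is a local parameter. No smaller positive multiple vanishes, by
`le_and_liesOver_of_nsmul_alb_eq_zero`. -/
theorem addOrderOf_alb_of_isRoot (hO : C.LiesOverInfinity O) {w : K} (hw : C.f.IsRoot w)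
    (hP : C.LiesOver P w 0) : addOrderOf (O.alb P) = d := by
  have hw0 : (0 : K) ^ d = C.f.eval w := by rw [zero_pow C.pos.ne']; exact hw.symm
  rw [addOrderOf_eq_iff C.pos]
  refine ⟨(nsmul_alb_eq_zero_iff_exists_fn hO hP.not_liesOverInfinity d).2
    ⟨Polynomial.C (X - Polynomial.C w), lt_of_le_of_lt degree_C_le (by exact_mod_cast C.pos),
      C_ne_zero.2 (X_sub_C_ne_zero w), ?_, ?_, ?_⟩, ?_⟩
  · rw [poleOrder_C, natDegree_X_sub_C, mul_one]
  · obtain ⟨q, hq, hqw⟩ := C.exists_eq_X_sub_C_mul hw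
    have hy : P.ord C.y = 1 := by
      have := hP.ord_localParameter hw0
      rwa [localParameter, if_pos rfl] at this
    have h1 : C.fn (Polynomial.C (X - Polynomial.C w)) * C.fn (Polynomial.C q) = C.y ^ d := by
      rw [C.y_pow, ← map_mul, ← map_mul, ← hq, fn_C]
    have hq0 : q ≠ 0 := by rintro rfl; simp at hqw
    have h2 := congrArg P.ord h1
    rw [P.ord_pow C.y_ne_zero, hy, P.ord_mul, hP.ord_fn_eq_zero hw0 (g := Polynomial.C q)
      (by simpa using hqw)] at h2
    · simpa using h2
    · rw [fn_C]; exact C.aeval_x_ne_zero (X_sub_C_ne_zero w)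
    · rw [fn_C]; exact C.aeval_x_ne_zero hq0
  · intro Q hQP hQ
    obtain ⟨b, c, hbc, hQbc⟩ := exists_liesOver hQ
    refine hQbc.ord_fn_eq_zero hbc ?_
    simp only [eval_C, eval_sub, eval_X]
    intro hbw
    obtain rfl := sub_eq_zero.1 hbw
    rw [← hw0, zero_pow C.pos.ne'] at hbc
    obtain rfl := pow_eq_zero_iff C.pos.ne' |>.1 hbc
    exact hQP ((C.existsUnique_liesOver hw0).unique hQbc hP)
  · intro m hmd hm0 hm
    exact hmd.not_ge (le_and_liesOver_of_nsmul_alb_eq_zero hO hP.not_liesOverInfinity hm0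
      (hmd.trans C.lt) hm).1

theorem exists_liesOver_of_addOrderOf_lt (hO : C.LiesOverInfinity O)
    (h1 : 1 < addOrderOf (O.alb P)) (hn : addOrderOf (O.alb P) < n) :
    ∃ w, C.f.IsRoot w ∧ C.LiesOver P w 0 :=
  (le_and_liesOver_of_nsmul_alb_eq_zero hO (not_liesOverInfinity_of_addOrderOf_ne_one hO h1.ne')
    (one_pos.trans h1) hn (addOrderOf_nsmul_eq_zero _)).2

theorem addOrderOf_alb_eq_d_iff (hO : C.LiesOverInfinity O) :
    addOrderOf (O.alb P) = d ↔ ∃ w : K, C.f.IsRoot w ∧ C.LiesOver P w 0 := by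
  refine ⟨fun h => exists_liesOver_of_addOrderOf_lt hO ?_ ?_, fun ⟨w, hw, hP⟩ =>
    addOrderOf_alb_of_isRoot hO hw hP⟩
  · rw [h]; exact C.two_le
  · rw [h]; exact C.lt

theorem ncard_addOrderOf_eq_d (hO : C.LiesOverInfinity O) :
    {P : C.Point | addOrderOf (O.alb P) = d}.ncard = n := by
  classical
  have hsep : C.f.Separable := PerfectField.separable_iff_squarefree.2 C.squarefree
  have hcard : C.f.roots.toFinset.card = n := by
    rw [Multiset.toFinset_card_of_nodup (nodup_roots hsep),
      splits_iff_card_roots.1 (IsAlgClosed.splits _), C.natDegree_eq]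
  have hmem : ∀ w ∈ C.f.roots.toFinset, C.f.IsRoot w := fun w hw =>
    (mem_roots'.1 (Multiset.mem_toFinset.1 hw)).2
  have hpt : ∀ w ∈ C.f.roots.toFinset, ∃ P : C.Point, C.LiesOver P w 0 := fun w hw =>
    (C.existsUnique_liesOver (by rw [zero_pow C.pos.ne']; exact (hmem w hw).symm)).exists
  choose pt hpt using hpt
  conv_rhs => rw [← hcard, ← Set.ncard_coe_finset]
  symm
  refine Set.ncard_congr pt (fun w hw => ?_) (fun w w' hw hw' h => ?_) fun P hP => ?_
  · exact addOrderOf_alb_of_isRoot hO (hmem w hw) (hpt w hw)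
  · have := hpt w' hw'
    rw [← h] at this
    exact ((hpt w hw).unique this).1
  · obtain ⟨w, hw, hPw⟩ := (addOrderOf_alb_eq_d_iff hO).1 hP
    have hw' : w ∈ (C.f.roots.toFinset : Set K) := by
      simpa [C.monic.ne_zero] using hw
    refine ⟨w, hw', ?_⟩
    exact (C.existsUnique_liesOver (by rw [zero_pow C.pos.ne']; exact hw.symm)).unique
      (hpt w hw') hPw

theorem eq_X_sub_C_pow_of_forall_root {p : K[X]} (hp : p.Monic) {a : K}
    (h : ∀ b, p.IsRoot b → b = a) : p = (X - Polynomial.C a) ^ p.natDegree := by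
  have hs := IsAlgClosed.splits p
  have h1 : p.roots = Multiset.replicate p.natDegree a :=
    Multiset.eq_replicate.2 ⟨splits_iff_card_roots.1 hs, fun b hb => h b (mem_roots'.1 hb).2⟩
  conv_lhs => rw [hs.eq_prod_roots, hp.leadingCoeff, h1]
  simp

theorem natDegree_cast_le_iff (hd : 0 < d) (k : ℕ) :
    (k : ℚ) ≤ ((n : ℚ) - 1) / d ↔ d * k < n := by
  rw [le_div_iff₀ (by exact_mod_cast hd), le_sub_iff_add_le, mul_comm]
  norm_cast

theorem exists_eq_of_addOrderOf_eq_n (hO : C.LiesOverInfinity O) {a c : K}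
    (hP : C.LiesOver P a c) (h : addOrderOf (O.alb P) = n) :
    ∃ v : K[X], d * v.natDegree < n ∧ C.f = (X - Polynomial.C a) ^ n + v ^ d := by
  have hn : n • O.alb P = 0 := by
    simpa only [h] using addOrderOf_nsmul_eq_zero (O.alb P)
  obtain ⟨g, hg, hg0, hgn, -, hQn⟩ :=
    (nsmul_alb_eq_zero_iff_exists_fn hO hP.not_liesOverInfinity n).1 hn
  obtain ⟨p, e, he, hpn, rfl⟩ := exists_eq_of_poleOrder_eq hgn
  have hvn : d * (Polynomial.C (-e⁻¹) * p).natDegree < n :=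
    (Nat.mul_le_mul_left d (natDegree_C_mul_le _ _)).trans_lt hpn
  -- With this `v`, the function `p + e y` is `e (y - v)`.
  refine ⟨Polynomial.C (-e⁻¹) * p, hvn, ?_⟩
  set v := Polynomial.C (-e⁻¹) * p with hv
  have hdeg : (v ^ d).degree < C.f.degree := by
    rw [degree_eq_natDegree C.monic.ne_zero, C.natDegree_eq]
    refine lt_of_le_of_lt degree_le_natDegree ?_
    rw [natDegree_pow]
    exact_mod_cast hvn
  have hmonic : (C.f - v ^ d).Monic := C.monic.sub_of_left hdeg
  have hnat : (C.f - v ^ d).natDegree = n := by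
    rw [natDegree_eq_of_degree_eq (degree_sub_eq_left_of_degree_lt hdeg), C.natDegree_eq]
  rw [← sub_eq_iff_eq_add]
  conv_rhs => rw [← hnat]
  -- A root `b` of `f - v ^ d` gives the point `(b, v(b))` of the curve, a zero of `y - v`, which
  -- must therefore be `P`.
  refine eq_X_sub_C_pow_of_forall_root hmonic fun b hb => ?_
  have hb' : (v.eval b) ^ d = C.f.eval b := by
    rw [IsRoot.def, eval_sub, eval_pow, sub_eq_zero] at hb
    exact hb.symm
  obtain ⟨Q, hQ, -⟩ := C.existsUnique_liesOver hb'
  have hpos := hQ.ord_fn_pos hb' (fun h => hg0 (C.fn_injOn hg h)) (by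
    rw [hv]
    simp [he])
  by_cases hQP : Q = P
  · subst hQP
    exact (hQ.unique hP).1
  · have := hQn Q hQP hQ.not_liesOverInfinity
    omega

/-- The function `y - v` has divisor `n (P) - n (O)`. Smaller orders would force `c = 0`, and then
`(x - a) ^ 2` would divide `f`. -/
theorem addOrderOf_eq_n_of_eq (hO : C.LiesOverInfinity O) {a c : K} (hac : c ^ d = C.f.eval a)
    (hP : C.LiesOver P a c) {v : K[X]} (hvn : d * v.natDegree < n)
    (hv : C.f = (X - Polynomial.C a) ^ n + v ^ d) (hvc : v.eval a = c) :
    addOrderOf (O.alb P) = n := by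
  have hn : 0 < n := C.pos.trans C.lt
  have hc : c ≠ 0 := by
    rintro rfl
    obtain ⟨q, hq⟩ := dvd_iff_isRoot.2 hvc
    refine not_isUnit_X_sub_C a (C.squarefree (X - Polynomial.C a) ?_)
    rw [← sq, hv]
    refine dvd_add (pow_dvd_pow _ (C.two_le.trans C.lt.le)) ?_
    rw [hq, mul_pow]
    exact Dvd.dvd.mul_right (pow_dvd_pow _ C.two_le) _
  have hdeg : (X - Polynomial.C v : K[X][X]).degree < d := by
    rw [degree_X_sub_C]
    exact_mod_cast C.two_le
  have hne : C.fn (X - Polynomial.C v) ≠ 0 := fun h => X_sub_C_ne_zero v (C.fn_injOn hdeg h)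
  rw [addOrderOf_eq_iff hn]
  refine ⟨(nsmul_alb_eq_zero_iff_exists_fn hO hP.not_liesOverInfinity n).2
    ⟨X - Polynomial.C v, hdeg, X_sub_C_ne_zero v, C.poleOrder_X_sub_C hvn, ?_, ?_⟩, ?_⟩
  · have hgeom := (Commute.all (X : K[X][X]) (Polynomial.C v)).geom_sum₂_mul d
    -- `G * (y - v) = y ^ d - v ^ d = (x - a) ^ n`, where `G(P) = d * c ^ (d - 1) ≠ 0` and `x - a`
    -- has order one at `P`.
    set G := ∑ i ∈ Finset.range d, (X : K[X][X]) ^ i * Polynomial.C v ^ (d - 1 - i) with hG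
    have hGP : (G.eval (Polynomial.C c)).eval a ≠ 0 := by
      have : ∀ i ∈ Finset.range d, c ^ i * c ^ (d - 1 - i) = c ^ (d - 1) := fun i hi => by
        rw [← pow_add]; congr 1; have := Finset.mem_range.1 hi; omega
      simp only [hG, eval_finsetSum, eval_mul, eval_pow, eval_X, eval_C, hvc]
      rw [Finset.sum_congr rfl this]
      simpa using ⟨C.natCast_ne_zero, fun h => absurd h hc⟩
    have hx : P.ord (C.fn (Polynomial.C (X - Polynomial.C a))) = 1 := by
      have := hP.ord_localParameter hac
      rwa [localParameter, if_neg hc, algebraMap_mk] at this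
    have hx0 : C.fn (Polynomial.C (X - Polynomial.C a)) ≠ 0 := by
      rw [fn_C]; exact C.aeval_x_ne_zero (X_sub_C_ne_zero a)
    have hprod : C.fn G * C.fn (X - Polynomial.C v) =
        C.fn (Polynomial.C (X - Polynomial.C a)) ^ n := by
      rw [← map_mul, hgeom, map_sub, map_pow, fn_X, y_pow, ← fn_C, ← map_sub, ← map_pow, ← map_pow,
        ← map_sub, hv, add_sub_cancel_right, map_pow]
    have hG0 : C.fn G ≠ 0 := fun h => by
      rw [h, zero_mul] at hprod
      exact pow_ne_zero n hx0 hprod.symm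
    have := congrArg P.ord hprod
    rw [P.ord_mul hG0 hne, P.ord_pow hx0, hx, hP.ord_fn_eq_zero hac hGP] at this
    simpa using this
  · intro Q hQP hQ
    obtain ⟨b, c', hbc, hQbc⟩ := exists_liesOver hQ
    refine hQbc.ord_fn_eq_zero hbc fun h0 => hQP ?_
    simp only [eval_sub, eval_X, eval_C, sub_eq_zero] at h0
    have hb : b = a := by
      have := hbc
      rw [hv, h0] at this
      simpa [sub_eq_zero, hn.ne'] using this
    subst hb
    obtain rfl : c' = c := h0.trans hvc
    exact (C.existsUnique_liesOver hac).unique hQbc hP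
  · intro m hmn hm0 hm
    obtain ⟨-, w, -, hw⟩ :=
      le_and_liesOver_of_nsmul_alb_eq_zero hO hP.not_liesOverInfinity hm0 hmn hm
    exact hc (hP.unique hw).2

theorem addOrderOf_alb_eq_n_iff (hO : C.LiesOverInfinity O) {a c : K} (hac : c ^ d = C.f.eval a)
    (hP : C.LiesOver P a c) : addOrderOf (O.alb P) = n ↔
      ∃ v : K[X], d * v.natDegree < n ∧ C.f = (X - Polynomial.C a) ^ n + v ^ d := by
  refine ⟨exists_eq_of_addOrderOf_eq_n hO hP, ?_⟩
  rintro ⟨v, hvn, hv⟩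
  have hn : 0 < n := C.pos.trans C.lt
  have hcv : c ^ d = v.eval a ^ d := by
    rw [hac, hv]; simp [hn.ne']
  -- The equation determines `v` only up to `d`-th roots of unity; `ζ * v` is the choice whose graph
  -- passes through `P`.
  obtain ⟨ζ, hζ, hζc⟩ : ∃ ζ : K, ζ ^ d = 1 ∧ ζ * v.eval a = c := by
    rcases eq_or_ne (v.eval a) 0 with h0 | h0
    · rw [h0, zero_pow C.pos.ne'] at hcv
      exact ⟨1, one_pow _, by rw [h0, mul_zero, (pow_eq_zero_iff C.pos.ne').1 hcv]⟩
    · exact ⟨c / v.eval a, by rw [div_pow, hcv, div_self (pow_ne_zero _ h0)], div_mul_cancel₀ _ h0⟩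
  refine addOrderOf_eq_n_of_eq hO hac hP (v := Polynomial.C ζ * v)
    ((Nat.mul_le_mul_left d (natDegree_C_mul_le _ _)).trans_lt hvn) ?_ (by simpa using hζc)
  rw [mul_pow, ← map_pow, hζ, map_one, one_mul, hv]

end AlgClosed

end SuperellipticCurve
end

/-! ### The main theorem -/

theorem theorem3p4 {K : Type*} [Field K] [IsAlgClosed K] {n d : ℕ}
    (C : SuperellipticCurve K n d) :
    -- The smooth projective model has one point at infinity, and its other points
    -- are identified with the points of the affine curve.
    (∃! O : C.Point, C.LiesOverInfinity O) ∧
    (∀ a c : K, c ^ d = C.f.eval a → ∃! P : C.Point, C.LiesOver P a c) ∧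
    (∀ P : C.Point, ¬ C.LiesOverInfinity P →
      ∃! p : K × K, p.2 ^ d = C.f.eval p.1 ∧ C.LiesOver P p.1 p.2) ∧
    ∀ O : C.Point, C.LiesOverInfinity O →
      -- orders greater than one
      (∀ (P : C.Point) (m : ℕ), 1 < m → addOrderOf (O.alb P) = m → m = d ∨ n ≤ m) ∧
      -- points of order `d`
      ({P : C.Point | addOrderOf (O.alb P) = d}.ncard = n ∧
        ∀ P : C.Point, addOrderOf (O.alb P) = d ↔ ∃ w : K, C.f.IsRoot w ∧ C.LiesOver P w 0) ∧
      -- points of order `n`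
      (∀ (a c : K) (P : C.Point), c ^ d = C.f.eval a → C.LiesOver P a c →
        (addOrderOf (O.alb P) = n ↔
          ∃ v : K[X], (v.natDegree : ℚ) ≤ ((n : ℚ) - 1) / d ∧
            C.f = (X - Polynomial.C a) ^ n + v ^ d)) ∧
      -- existence of points of order `n`
      ((∃ P : C.Point, addOrderOf (O.alb P) = n) ↔
        ∃ (a : K) (v : K[X]), (v.natDegree : ℚ) ≤ ((n : ℚ) - 1) / d ∧
          C.f = (X - Polynomial.C a) ^ n + v ^ d) := by
  have hn : 0 < n := C.pos.trans C.lt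
  simp only [SuperellipticCurve.natDegree_cast_le_iff C.pos]
  refine ⟨C.existsUnique_liesOverInfinity, fun a c hac => C.existsUnique_liesOver hac,
    fun P hP => ?_, fun O hO => ⟨?_, ⟨SuperellipticCurve.ncard_addOrderOf_eq_d hO,
      fun P => SuperellipticCurve.addOrderOf_alb_eq_d_iff hO⟩,
      fun a c P hac hP => SuperellipticCurve.addOrderOf_alb_eq_n_iff hO hac hP, ?_⟩⟩
  · obtain ⟨a, c, hac, hPac⟩ := SuperellipticCurve.exists_liesOver hP
    refine ⟨(a, c), ⟨hac, hPac⟩, ?_⟩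
    rintro ⟨a', c'⟩ ⟨-, h⟩
    obtain ⟨rfl, rfl⟩ := hPac.unique h
    rfl
  · rintro P m hm rfl
    by_contra! h
    obtain ⟨w, hw, hP⟩ := SuperellipticCurve.exists_liesOver_of_addOrderOf_lt hO hm h.2
    exact h.1 (SuperellipticCurve.addOrderOf_alb_of_isRoot hO hw hP)
  · constructor
    · rintro ⟨P, hP⟩
      have h1 : addOrderOf (O.alb P) ≠ 1 := by
        have := C.two_le.trans_lt C.lt
        omega
      obtain ⟨a, c, hac, hPac⟩ := SuperellipticCurve.exists_liesOver
        (SuperellipticCurve.not_liesOverInfinity_of_addOrderOf_ne_one hO h1)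
      exact ⟨a, (SuperellipticCurve.addOrderOf_alb_eq_n_iff hO hac hPac).1 hP⟩
    · rintro ⟨a, v, hvn, hv⟩
      -- The point of order `n` is `(a, v(a))`.
      have hac : (v.eval a) ^ d = C.f.eval a := by
        rw [hv]; simp [hn.ne']
      obtain ⟨P, hP, -⟩ := C.existsUnique_liesOver hac
      exact ⟨P, (SuperellipticCurve.addOrderOf_alb_eq_n_iff hO hac hP).2 ⟨v, hvn, hv⟩⟩
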